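/- **Setting.** Consider a finite state space $\mathcal S$, a finite action set $\mathcal A$ with $A=|\mathcal A|$, nonempty sets $\mathcal A_s\subseteq\mathcal A$ of actions allowed in state $s$, and transition probabilities $P(s'\mid s,a)$, such that every deterministic stationary policy $\beta$ (a map $\mathcal S\to\mathcal A$ with $\beta(s)\in\mathcal A_s$) induces an irreducible and aperiodic Markov chain; $\pi_\beta$ denotes its stationary distribution. (For an energy harvesting transmitter the state is the battery level, the action is the transmit power, and $s_{t+1}=\min\{s_t-a_t+p_t,Q_{\max}\}$ with harvested powers $p_t$.) There are $M\ge 1$ channels. In each slot $t=1,2,\dots$ the agent sees the state $s_t$, chooses $a_t\in\mathcal A_{s_t}$ and a channel $j_t$, and receives the rate $r_t=f(a_t,X_{t,j_t})$, where $f\ge 0$ is a known function such that every $f(a,\cdot)$ is measurable and bounded on the set $\mathcal X$ of possible gains. The gains $X_{t,j}$ of channel $j$ are i.i.d. over $t$ with unknown law, and the gains of slot $t$ are independent of everything known when the decision of slot $t$ is made; given that information, the next state has law $P(\cdot\mid s_t,a_t)$. Put $\mu_j(a)=\mathbb E f(a,X_j)$, $\phi^*(a)\in\arg\max_j\mu_j(a)$,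 $\mu^*(a)=\max_j\mu_j(a)$, $\rho(\beta)=\sum_s\pi_\beta(s)\,\mu^*(\beta(s))$, $\beta^*\in\arg\max_\beta\rho(\beta)$, $\rho^*=\rho(\beta^*)$, and let $P_*$ be the transition matrix of $\beta^*$. The $T$-slot regret is $\mathfrak R(T)=T\rho^*-\mathbb E\big[\sum_{t=1}^T r_t\big]$. Define $$\gamma=\max_{s,s'}\|P_*(s',\cdot)-P_*(s,\cdot)\|_{\mathrm{TV}},\quad \mu_{\max}=\max_a\mu^*(a),\quad \Delta_{\max}=\rho^*-\min_{a,j}\mu_j(a),$$ $$\Delta_3=\min\{\mu^*(a)-\mu_j(a): a\in\mathcal A,\ j\notin\arg\max_i\mu_i(a)\},\quad \Delta_4=\rho^*-\max_{\beta\ne\beta^*}\rho(\beta),\quad B_0=\max_a\Big(\sup_{x\in\mathcal X} f(a,x)-\inf_{x\in\mathcal X} f(a,x)\Big),$$ where $\Delta_3$ and $\Delta_4$ are $+\infty$ if the minimum, respectively the maximum, is over the empty set. Assume $B_0>0$ and $\gamma<1$ (the latter is automatic for the energy harvesting transmitter if every harvested power $0,\dots,Q_{\max}$ has positive probability). **Algorithm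 MC-LPSM.** Let $\mathcal R\subseteq\{1,2,\dots\}$ be the set of exploration slots and $\mathcal R(t)=\mathcal R\cap[1,t]$. The algorithm keeps estimates $\theta_j(a)$ and counters $m_j$, initially $0$. In a slot $n\in\mathcal R$ it uses channel $j=((n-1)\bmod M)+1$ with an arbitrary valid action, and then sets $\theta_j(a)\leftarrow\frac{m_j\theta_j(a)+f(a,X_{n,j})}{m_j+1}$ for all $a\in\mathcal A$ and $m_j\leftarrow m_j+1$. In a slot $n\notin\mathcal R$ with $n-1\in\mathcal R$ it picks $\phi(a)\in\arg\max_j\theta_j(a)$ for all $a$, a solution $\pi$ of the linear program $$\max\sum_{s}\sum_{a\in\mathcal A_s}\pi(s,a)\,\theta_{\phi(a)}(a)\quad\text{s.t. } \pi\ge 0,\ \sum_{s}\sum_{a\in\mathcal A_s}\pi(s,a)=1,\ \sum_{a\in\mathcal A_{s'}}\pi(s',a)=\sum_s\sum_{a\in\mathcal A_s}\pi(s,a)P(s'\mid s,a)\ \ \forall s',$$ and $\beta(s)\in\arg\max_{a\in\mathcal A_s}\pi(s,a)$, with ties broken arbitrarily; in the other slots $n\notin\mathcal R$, $n\ge2$,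 it keeps $\beta$ and $\phi$. In every slot $n\notin\mathcal R$ it plays $a_n=\beta(s_n)$ on channel $\phi(a_n)$. (If $1\notin\mathcal R$, then $\beta,\phi$ are arbitrary in slot $1$.) **Theorem.** Let $0<d\le\min\{\Delta_3,\Delta_4\}$ and $w>\frac{2B_0^2}{d^2}$, and let $\mathcal R$ be such that for every $t>1$: $t\in\mathcal R$ if and only if $|\mathcal R(t-1)|<M\lceil w\ln t\rceil$ (slot $1$ may or may not belong to $\mathcal R$). Then, for every initial distribution of the state and every $T\ge1$, MC-LPSM satisfies $$\mathfrak R(T)\le\Big(M\lceil w\ln T\rceil+2AM\,c_{(wd^2/(2B_0^2))}\Big)\Big(\Delta_{\max}+\frac{\mu_{\max}}{1-\gamma}\Big),\qquad c_{(x)}=\sum_{t=1}^\infty t^{-x},$$ where the series $c_{(wd^2/(2B_0^2))}$ converges. -/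

import Mathlib

open MeasureTheory ProbabilityTheory
open scoped Matrix

namespace MCLPSM

noncomputable section

/-! ### Finite Markov decision processes -/

/-- The controlled dynamics of a finite Markov decision process: the set `act s` of actions allowed
in state `s` and the probabilities `trans s a s'` of moving from `s` to `s'` under action `a`.
Rewards are handled separately, since they depend on the action and the channel only. -/
structure MDP (S A : Type*) [Fintype S] where
  act : S → Finset A
  act_nonempty : ∀ s, (act s).Nonempty
  trans : S → A → S → ℝ
  trans_nonneg : ∀ s, ∀ a ∈ act s, ∀ s', 0 ≤ trans s a s'
  trans_sum : ∀ s, ∀ a ∈ act s, ∑ s', trans s a s' = 1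

/-- Deterministic stationary policies (state-action mappings). -/
abbrev MDP.Policy {S A : Type*} [Fintype S] (𝓜 : MDP S A) : Type _ :=
  (s : S) → {a : A // a ∈ 𝓜.act s}

instance {S A : Type*} [Fintype S] (𝓜 : MDP S A) : Nonempty 𝓜.Policy :=
  ⟨fun s => ⟨(𝓜.act_nonempty s).choose, (𝓜.act_nonempty s).choose_spec⟩⟩

/-- Transition matrix of the Markov chain induced by a policy. -/
def MDP.chain {S A : Type*} [Fintype S] (𝓜 : MDP S A) (β : 𝓜.Policy) : Matrix S S ℝ :=
  Matrix.of fun s s' => 𝓜.trans s (β s) s'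

/-- A nonnegative matrix is aperiodic if, for every state, the set of its possible return times
has greatest common divisor `1`. -/
def IsAperiodic {S : Type*} [Fintype S] [DecidableEq S] (P : Matrix S S ℝ) : Prop :=
  ∀ s, ∀ k : ℕ, (∀ n, 1 ≤ n → 0 < (P ^ n) s s → k ∣ n) → k = 1

/-- An MDP is ergodic if every deterministic stationary policy induces an irreducible and aperiodic
Markov chain. -/
def MDP.IsErgodic {S A : Type*} [Fintype S] [DecidableEq S] (𝓜 : MDP S A) : Prop :=
  ∀ β : 𝓜.Policy, (𝓜.chain β).IsIrreducible ∧ IsAperiodic (𝓜.chain β)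

/-- `π` is a stationary distribution of the transition matrix `P`. -/
def IsStationary {S : Type*} [Fintype S] (P : Matrix S S ℝ) (π : S → ℝ) : Prop :=
  (∀ s, 0 ≤ π s) ∧ ∑ s, π s = 1 ∧ π ᵥ* P = π

/-- The stationary distribution `π_β` of a policy (it exists and is unique in an ergodic MDP). -/
def MDP.stationaryDist {S A : Type*} [Fintype S] (𝓜 : MDP S A) (β : 𝓜.Policy) : S → ℝ :=
  Classical.epsilon (IsStationary (𝓜.chain β))

/-- Total variation distance `max_E |p(E) - q(E)|` between distributions on a finite set. -/
def tvDist {S : Type*} [Fintype S] (p q : S → ℝ) : ℝ :=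
  ⨆ E : Finset S, |∑ s ∈ E, p s - ∑ s ∈ E, q s|

/-- `max_{s, s'} ‖P(s', ·) - P(s, ·)‖_TV`. -/
def contraction {S : Type*} [Fintype S] (P : Matrix S S ℝ) : ℝ :=
  ⨆ s : S, ⨆ s' : S, tvDist (P s') (P s)

/-! ### The average reward linear program -/

/-- Feasible points `π(s, a)`, `a ∈ act s`, of the average reward LP. -/
def MDP.LPFeasible {S A : Type*} [Fintype S] (𝓜 : MDP S A) (π : S → A → ℝ) : Prop :=
  (∀ s, ∀ a ∈ 𝓜.act s, 0 ≤ π s a) ∧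
  (∑ s, ∑ a ∈ 𝓜.act s, π s a = 1) ∧
  (∀ s', ∑ a ∈ 𝓜.act s', π s' a = ∑ s, ∑ a ∈ 𝓜.act s, π s a * 𝓜.trans s a s')

/-- Objective of the LP for action rewards `r`. -/
def MDP.lpValue {S A : Type*} [Fintype S] (𝓜 : MDP S A) (r : A → ℝ) (π : S → A → ℝ) : ℝ :=
  ∑ s, ∑ a ∈ 𝓜.act s, π s a * r a

/-- `π` solves the LP with action rewards `r`. -/
def MDP.IsLPSolution {S A : Type*} [Fintype S] (𝓜 : MDP S A) (r : A → ℝ) (π : S → A → ℝ) : Prop :=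
  𝓜.LPFeasible π ∧ ∀ π', 𝓜.LPFeasible π' → 𝓜.lpValue r π' ≤ 𝓜.lpValue r π

/-- `β` is obtained from some solution `π` of the LP by `β(s) ∈ argmax_{a ∈ act s} π(s, a)`. -/
def MDP.IsLPPolicy {S A : Type*} [Fintype S] (𝓜 : MDP S A) (r : A → ℝ) (β : 𝓜.Policy) : Prop :=
  ∃ π, 𝓜.IsLPSolution r π ∧ ∀ s, ∀ a ∈ 𝓜.act s, π s a ≤ π s (β s)

/-! ### Multi-channel quantities, for a matrix `m` of mean rates `m j a` -/

/-- Mean rate of channel `j` under action `a`, for gain laws `ν j` and rate function `f`. -/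
def meanRate {A 𝒳 : Type*} [MeasurableSpace 𝒳] {M : ℕ} (f : A → 𝒳 → ℝ)
    (ν : Fin M → Measure 𝒳) (j : Fin M) (a : A) : ℝ :=
  ∫ x, f a x ∂(ν j)

/-- `φ*(a)`: a channel of maximal mean rate for the action `a`. -/
def bestChannel {A : Type*} {M : ℕ} [NeZero M] (m : Fin M → A → ℝ) (a : A) : Fin M :=
  (Finite.exists_max fun j => m j a).choose

/-- `μ*(a)`: the mean rate of the best channel for `a`. -/
def bestRate {A : Type*} {M : ℕ} [NeZero M] (m : Fin M → A → ℝ) (a : A) : ℝ :=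
  m (bestChannel m a) a

/-- `ρ(β, φ, m) = ∑_s π_β(s) m_{φ(β(s))}(β(s))`. -/
def MDP.avgRate {S A : Type*} [Fintype S] (𝓜 : MDP S A) {M : ℕ} (m : Fin M → A → ℝ)
    (β : 𝓜.Policy) (φ : A → Fin M) : ℝ :=
  ∑ s, 𝓜.stationaryDist β s * m (φ (β s)) (β s)

/-- `β*`: a policy of maximal average rate under the best channel mapping `φ*`. -/
def MDP.bestPolicy {S A : Type*} [Fintype S] [Finite A] (𝓜 : MDP S A) {M : ℕ} [NeZero M]
    (m : Fin M → A → ℝ) : 𝓜.Policy :=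
  (Finite.exists_max fun β : 𝓜.Policy => 𝓜.avgRate m β (bestChannel m)).choose

/-- `ρ* = ρ(β*, φ*, m)`. -/
def MDP.optRate {S A : Type*} [Fintype S] [Finite A] (𝓜 : MDP S A) {M : ℕ} [NeZero M]
    (m : Fin M → A → ℝ) : ℝ :=
  𝓜.avgRate m (𝓜.bestPolicy m) (bestChannel m)

/-- `γ = max_{s, s'} ‖P_*(s', ·) - P_*(s, ·)‖_TV`, with `P_*` the chain of `β*`. -/
def MDP.gamma {S A : Type*} [Fintype S] [Finite A] (𝓜 : MDP S A) {M : ℕ} [NeZero M]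
    (m : Fin M → A → ℝ) : ℝ :=
  contraction (𝓜.chain (𝓜.bestPolicy m))

/-- `μ_max = max_a μ*(a)`. -/
def muMax {A : Type*} {M : ℕ} [NeZero M] (m : Fin M → A → ℝ) : ℝ :=
  ⨆ a, bestRate m a

/-- `Δ_max = ρ* - min_{a, j} μ_j(a)`. -/
def MDP.deltaMax {S A : Type*} [Fintype S] [Finite A] (𝓜 : MDP S A) {M : ℕ} [NeZero M]
    (m : Fin M → A → ℝ) : ℝ :=
  𝓜.optRate m - ⨅ p : A × Fin M, m p.2 p.1

/-- `Δ₃`: the smallest gap `μ*(a) - μ_j(a)` over actions `a` and channels `j` that are not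
optimal for `a` (`⊤` if there are none). -/
def delta3 {A : Type*} {M : ℕ} [NeZero M] (m : Fin M → A → ℝ) : EReal :=
  ⨅ (a : A) (j : Fin M) (_ : m j a < bestRate m a), ((bestRate m a - m j a : ℝ) : EReal)

/-- `Δ₄ = ρ* - max_{β ≠ β*} ρ(β, φ*, m)` (`⊤` if there is only one policy). -/
def MDP.delta4 {S A : Type*} [Fintype S] [Finite A] (𝓜 : MDP S A) {M : ℕ} [NeZero M]
    (m : Fin M → A → ℝ) : EReal :=
  ⨅ (β : 𝓜.Policy) (_ : β ≠ 𝓜.bestPolicy m),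
    ((𝓜.optRate m - 𝓜.avgRate m β (bestChannel m) : ℝ) : EReal)

/-- `B₀ = max_a (sup_x f(a, x) - inf_x f(a, x))`. -/
def rateRange {A 𝒳 : Type*} (f : A → 𝒳 → ℝ) : ℝ :=
  ⨆ a, ((⨆ x, f a x) - ⨅ x, f a x)

/-- `c_(x) = ∑_{t ≥ 1} t^{-x}`. -/
def zetaSum (x : ℝ) : ℝ := ∑' t : ℕ, ((t : ℝ) + 1) ^ (-x)

/-! ### The algorithm; time slots are `1, 2, 3, …` -/

/-- `R` is a set of slots built by the rule: a slot `t > 1` belongs to `R` if and only if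
`|R ∩ [1, t - 1]| < M ⌈w ln t⌉`. (Slot `1` may or may not belong to `R`.) -/
def IsExplorationSequence (M : ℕ) (w : ℝ) (R : Set ℕ) : Prop :=
  0 ∉ R ∧ ∀ t : ℕ, 1 < t →
    (t ∈ R ↔ ((R ∩ Set.Icc 1 (t - 1)).ncard : ℤ) < M * ⌈w * Real.log t⌉)

/-- The channel explored in slot `n` when `n` is an exploration slot: channel `(n - 1) mod M`,
where the channels are numbered `0, …, M - 1`. -/
def roundRobin (M : ℕ) [NeZero M] (n : ℕ) : Fin M := Fin.ofNat M (n - 1)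

open Classical in
/-- `m_j` after slot `n`: how often channel `j` has been explored. -/
def exploreCount {M : ℕ} [NeZero M] (R : Set ℕ) : ℕ → Fin M → ℕ
  | 0, _ => 0
  | n + 1, j =>
    if n + 1 ∈ R ∧ roundRobin M (n + 1) = j then exploreCount R n j + 1 else exploreCount R n j

open Classical in
/-- `θ_j(a)` after slot `n`, where `x n j` is the gain of channel `j` in slot `n`. -/
def estimate {A 𝒳 : Type*} {M : ℕ} [NeZero M] (f : A → 𝒳 → ℝ) (R : Set ℕ)
    (x : ℕ → Fin M → 𝒳) : ℕ → Fin M → A → ℝ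
  | 0, _, _ => 0
  | n + 1, j, a =>
    if n + 1 ∈ R ∧ roundRobin M (n + 1) = j then
      (exploreCount R n j * estimate f R x n j a + f a (x (n + 1) j)) / (exploreCount R n j + 1)
    else estimate f R x n j a

/-- The random environment together with an agent acting in it. `ℱ n` is the information
available when the decision of slot `n` is taken (it may contain additional randomization),
`X n j` the gain of channel `j` in slot `n`, and `st n`, `ac n`, `ch n` the state, action and
channel of slot `n`. The gains of slot `n` are independent of `ℱ n`, and channel `j` has gain law
`ν j` in every slot, so that the gains are i.i.d. over time. -/
structure IsControlledSystem {S A 𝒳 Ω : Type*} [Fintype S] [MeasurableSpace 𝒳]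
    {mΩ : MeasurableSpace Ω} {M : ℕ} (𝓜 : MDP S A) (ν : Fin M → Measure 𝒳) (Pr : Measure Ω)
    (ℱ : Filtration ℕ mΩ) (X : ℕ → Ω → Fin M → 𝒳) (st : ℕ → Ω → S) (ac : ℕ → Ω → A)
    (ch : ℕ → Ω → Fin M) : Prop where
  state_adapted : ∀ n, 1 ≤ n → ∀ s, MeasurableSet[ℱ n] {ω | st n ω = s}
  action_adapted : ∀ n, 1 ≤ n → ∀ a, MeasurableSet[ℱ n] {ω | ac n ω = a}
  channel_adapted : ∀ n, 1 ≤ n → ∀ j, MeasurableSet[ℱ n] {ω | ch n ω = j}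
  action_valid : ∀ n, 1 ≤ n → ∀ ω, ac n ω ∈ 𝓜.act (st n ω)
  gain_observed : ∀ n, 1 ≤ n → Measurable[ℱ (n + 1)] (X n)
  gain_law : ∀ n, 1 ≤ n → ∀ j, Pr.map (fun ω => X n ω j) = ν j
  gain_indep : ∀ n, 1 ≤ n → Indep (MeasurableSpace.comap (X n) inferInstance) (ℱ n) Pr
  transition : ∀ n, 1 ≤ n → ∀ s',
    Pr[({ω | st (n + 1) ω = s'}.indicator fun _ => (1 : ℝ)) | ℱ n]
      =ᵐ[Pr] fun ω => 𝓜.trans (st n ω) (ac n ω) s'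

/-- The agent follows MC-LPSM with exploration slots `R`. In an exploitation slot `n`, `β n` and
`φ n` are the power and channel selection policies in force. Ties in the maximizations are broken
arbitrarily. In slot `1`, if it is not an exploration slot, `β 1` and `φ 1` are arbitrary. -/
structure IsMCLPSM {S A 𝒳 Ω : Type*} [Fintype S] {mΩ : MeasurableSpace Ω} {M : ℕ} [NeZero M]
    (𝓜 : MDP S A) (f : A → 𝒳 → ℝ) (R : Set ℕ) (ℱ : Filtration ℕ mΩ)
    (X : ℕ → Ω → Fin M → 𝒳) (st : ℕ → Ω → S) (ac : ℕ → Ω → A) (ch : ℕ → Ω → Fin M)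
    (β : ℕ → Ω → 𝓜.Policy) (φ : ℕ → Ω → A → Fin M) : Prop where
  /-- round-robin exploration (with any valid action) -/
  explore : ∀ n, 1 ≤ n → n ∈ R → ∀ ω, ch n ω = roundRobin M n
  policy_adapted : ∀ n, 1 ≤ n → n ∉ R → ∀ b, MeasurableSet[ℱ n] {ω | β n ω = b}
  mapping_adapted : ∀ n, 1 ≤ n → n ∉ R → ∀ p, MeasurableSet[ℱ n] {ω | φ n ω = p}
  /-- right after an exploration slot, `φ` picks the empirically best channels … -/
  mapping_update : ∀ n, 2 ≤ n → n ∉ R → n - 1 ∈ R → ∀ ω a j,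
    estimate f R (fun k => X k ω) (n - 1) j a
      ≤ estimate f R (fun k => X k ω) (n - 1) (φ n ω a) a
  /-- … and `β` is computed from the LP with the estimated rates of these channels -/
  policy_update : ∀ n, 2 ≤ n → n ∉ R → n - 1 ∈ R → ∀ ω,
    𝓜.IsLPPolicy (fun a => estimate f R (fun k => X k ω) (n - 1) (φ n ω a) a) (β n ω)
  /-- otherwise the policies of the previous exploitation slot are kept -/
  keep : ∀ n, 2 ≤ n → n ∉ R → n - 1 ∉ R → ∀ ω,
    β n ω = β (n - 1) ω ∧ φ n ω = φ (n - 1) ω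
  exploit : ∀ n, 1 ≤ n → n ∉ R → ∀ ω,
    ac n ω = β n ω (st n ω) ∧ ch n ω = φ n ω (ac n ω)

/-- Expected `T`-slot regret with respect to the benchmark mean rate `ρ`. -/
def regret {A 𝒳 Ω : Type*} [MeasurableSpace Ω] {M : ℕ} (Pr : Measure Ω) (f : A → 𝒳 → ℝ) (ρ : ℝ)
    (X : ℕ → Ω → Fin M → 𝒳) (ac : ℕ → Ω → A) (ch : ℕ → Ω → Fin M) (T : ℕ) : ℝ :=
  T * ρ - ∫ ω, ∑ n ∈ Finset.Icc 1 T, f (ac n ω) (X n ω (ch n ω)) ∂Pr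

/-! ### The energy harvesting transmitter as an instance -/

/-- The battery MDP: states and transmit powers are `0, …, Q`, the transmit power is at most the
stored energy and positive if the latter is, and the battery level is updated by
`s' = min (s - a + p) Q`, where `p` is the harvested power with distribution `harvest`. -/
def batteryMDP (Q : ℕ) (harvest : PMF ℕ) : MDP (Fin (Q + 1)) (Fin (Q + 1)) where
  act s := {a | a ≤ s ∧ (0 < s → 0 < a)}
  act_nonempty s := ⟨s, by simp⟩
  trans s a s' := ((harvest.map fun p =>
    (⟨min ((s : ℕ) - a + p) Q, by omega⟩ : Fin (Q + 1))) s').toReal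
  trans_nonneg _ _ _ _ := ENNReal.toReal_nonneg
  trans_sum s a _ := by
    rw [← ENNReal.toReal_sum fun _ _ => PMF.apply_ne_top _ _, ← tsum_fintype (L := .unconditional _),
      PMF.tsum_coe, ENNReal.toReal_one]

lemma batteryMDP_trans_pos {Q : ℕ} {harvest : PMF ℕ} (s a s' : Fin (Q + 1)) (p : ℕ)
    (hp : harvest p ≠ 0) (h : min ((s : ℕ) - a + p) Q = s') :
    0 < (batteryMDP Q harvest).trans s a s' := by
  refine ENNReal.toReal_pos ?_ (PMF.apply_ne_top _ _)
  rw [← PMF.mem_support_iff, PMF.mem_support_map_iff]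
  exact ⟨p, (PMF.mem_support_iff _ _).2 hp, Fin.ext h⟩

/-- The battery MDP is ergodic if every harvest level `0, …, Q` has positive probability. -/
theorem batteryMDP_isErgodic {Q : ℕ} {harvest : PMF ℕ} (hp : ∀ p ≤ Q, harvest p ≠ 0) :
    (batteryMDP Q harvest).IsErgodic := by
  intro β
  set P := (batteryMDP Q harvest).chain β with hP
  have hβ : ∀ s : Fin (Q + 1), ((β s : Fin (Q + 1)) : ℕ) ≤ s ∧
      (0 < (s : ℕ) → 0 < ((β s : Fin (Q + 1)) : ℕ)) := by
    intro s
    have h := (β s).2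
    simp only [batteryMDP, Finset.mem_filter, Finset.mem_univ, true_and] at h
    exact ⟨h.1, fun h0 => h.2 h0⟩
  have hnn : ∀ s s', 0 ≤ P s s' := fun s s' => ENNReal.toReal_nonneg
  have hup : ∀ s s' : Fin (Q + 1), (s : ℕ) ≤ s' → 0 < P s s' := by
    intro s s' hs
    have h1 := hβ s
    refine batteryMDP_trans_pos s (β s) s' (s' - (s - (β s : Fin (Q + 1)))) (hp _ ?_) ?_ <;> omega
  have hdown : ∀ s s' : Fin (Q + 1), (s : ℕ) = s' + 1 → 0 < P s s' := by
    intro s s' hs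
    have h1 := hβ s
    refine batteryMDP_trans_pos s (β s) s' ((β s : Fin (Q + 1)) - 1) (hp _ ?_) ?_ <;> omega
  have hpow : ∀ k : ℕ, ∀ s s' : Fin (Q + 1), (s : ℕ) = s' + k → 0 < (P ^ (k + 1)) s s' := by
    intro k
    induction k with
    | zero => intro s s' h; simpa using hup s s' (by omega)
    | succ k ih =>
      intro s s' h
      rw [pow_succ', Matrix.mul_apply]
      refine Finset.sum_pos' (fun i _ => mul_nonneg (hnn _ _) (Matrix.pow_apply_nonneg hnn _ _ _))
        ⟨⟨s - 1, by omega⟩, Finset.mem_univ _, mul_pos (hdown _ _ ?_) (ih _ _ ?_)⟩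
      · simp only; omega
      · simp only; omega
  refine ⟨(Matrix.isIrreducible_iff_exists_pow_pos hnn).2 fun s s' => ?_, fun s k hk => ?_⟩
  · rcases le_total (s : ℕ) s' with h | h
    · exact ⟨1, one_pos, by simpa using hup s s' h⟩
    · exact ⟨s - s' + 1, by omega, hpow _ _ _ (by omega)⟩
  · simpa using hk 1 le_rfl (by simpa using hup s s le_rfl)

lemma sum_sub_sum_lt_one {S : Type*} [Fintype S] {p q : S → ℝ} (hp : ∀ s, 0 ≤ p s)
    (hq : ∀ s, 0 ≤ q s) (hp1 : ∑ s, p s = 1) {s₀ : S} (hps : 0 < p s₀) (hqs : 0 < q s₀)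
    (E : Finset S) : ∑ s ∈ E, p s - ∑ s ∈ E, q s < 1 := by
  classical
  by_cases h : s₀ ∈ E
  · have h1 := Finset.sum_le_univ_sum_of_nonneg (s := E) hp
    have h2 := Finset.single_le_sum (fun s _ => hq s) h
    linarith
  · have h1 := Finset.sum_le_univ_sum_of_nonneg (s := insert s₀ E) hp
    rw [Finset.sum_insert h] at h1
    have h2 := Finset.sum_nonneg fun s (_ : s ∈ E) => hq s
    linarith

/-- In the battery MDP, `γ < 1` holds automatically. -/
theorem batteryMDP_contraction_lt_one {Q : ℕ} {harvest : PMF ℕ} (hp : ∀ p ≤ Q, harvest p ≠ 0)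
    (β : (batteryMDP Q harvest).Policy) : contraction ((batteryMDP Q harvest).chain β) < 1 := by
  set P := (batteryMDP Q harvest).chain β with hP
  have hnn : ∀ s s', 0 ≤ P s s' := fun s s' => ENNReal.toReal_nonneg
  have hsum : ∀ s, ∑ s', P s s' = 1 := fun s => (batteryMDP Q harvest).trans_sum s (β s) (β s).2
  have hlast : ∀ s, 0 < P s (Fin.last Q) := fun s =>
    batteryMDP_trans_pos s (β s) (Fin.last Q) Q (hp Q le_rfl) (by simp)
  unfold contraction
  obtain ⟨s, hs⟩ := exists_eq_ciSup_of_finite (f := fun s => ⨆ s', tvDist (P s') (P s))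
  rw [← hs]
  obtain ⟨s', hs'⟩ := exists_eq_ciSup_of_finite (f := fun s' => tvDist (P s') (P s))
  simp only [← hs']
  unfold tvDist
  obtain ⟨E, hE⟩ := exists_eq_ciSup_of_finite
    (f := fun E : Finset (Fin (Q + 1)) => |∑ x ∈ E, P s' x - ∑ x ∈ E, P s x|)
  rw [← hE, abs_lt]
  have h1 := sum_sub_sum_lt_one (hnn s') (hnn s) (hsum s') (hlast s') (hlast s) E
  have h2 := sum_sub_sum_lt_one (hnn s) (hnn s') (hsum s) (hlast s) (hlast s') E
  constructor <;> linarith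

end

end MCLPSM

open MCLPSM

/-! The regret is measured against the bias function `h` of the optimal policy, the solution of its
Poisson equation `μ* + P_* h = ρ* + h`. Since `P_*` shrinks oscillations by the factor `γ < 1`, `h`
exists and oscillates by at most `D = μ_max / (1 - γ)` (`exists_poisson`, `exists_bias`). The
expected loss of a slot equals the expected increment of `h` along the states plus an expected
correction. The correction vanishes where the optimal action and a best channel are used, and never
exceeds `K = Δ_max + D`. The increments telescope to at most `D`, so the regret is at most `D` plus
`K` times a bound on the expected number of bad slots.

Bad slots are slot 1, the exploration slots, and the exploitation slots in which some estimate is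
off by at least `d / 2`. Smaller errors are harmless. Because `d ≤ Δ₃`, the empirically best
channels are truly best. Because `d ≤ Δ₄`, `β*` remains the unique optimal policy for the estimated
rewards, and the linear program then returns it: every other action has negative advantage, so an
optimal `π` lives on `β*`, and irreducibility gives it positive mass in every state
(`MDP.IsLPPolicy.eq_of_unique`).

Exploration runs in uninterrupted blocks of `M` slots, so before an exploitation slot `n` each
channel has at least `w ln n` samples (`IsExplorationSequence.ceil_le_exploreCount`). Hoeffding's
inequality and a union bound give failure probability `2AM n ^ (-w d² / (2 B₀²))`, which is summable
by the choice of `w`. -/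

namespace MCLPSM

/-! ### Stationary distributions -/

section Stationary

variable {S : Type*} [Fintype S]

lemma IsStationary.sum_mul {P : Matrix S S ℝ} {π : S → ℝ} (h : IsStationary P π) (g : S → ℝ) :
    ∑ s, π s * ∑ s', P s s' * g s' = ∑ s, π s * g s := by
  change π ⬝ᵥ (P *ᵥ g) = π ⬝ᵥ g
  rw [Matrix.dotProduct_mulVec, h.2.2]

/-- Every stochastic matrix has a stationary distribution. -/
theorem exists_isStationary [DecidableEq S] [Nonempty S] {P : Matrix S S ℝ}
    (hP : ∀ s s', 0 ≤ P s s') (hP1 : ∀ s, ∑ s', P s s' = 1) : ∃ π, IsStationary P π := by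
  -- The constant vector is a right null vector of `1 - P`; singularity then supplies a left one.
  have hdet : (1 - P).det = 0 := by
    refine Matrix.exists_mulVec_eq_zero_iff.1 ⟨1, one_ne_zero, ?_⟩
    rw [Matrix.sub_mulVec, Matrix.one_mulVec]
    ext s
    simp [Matrix.mulVec, dotProduct, hP1]
  obtain ⟨v, hv0, hv⟩ := Matrix.exists_vecMul_eq_zero_iff.2 hdet
  rw [Matrix.vecMul_sub, Matrix.vecMul_one, sub_eq_zero] at hv
  have hv' : ∀ s', v s' = ∑ s, v s * P s s' := fun s' => congrFun hv s'
  -- The fixed vector `v` may have mixed signs. But `|v| ≤ |v| P` entrywise and both sides have the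
  -- same total mass, so `|v|` is fixed as well.
  have hle : ∀ s', |v s'| ≤ ∑ s, |v s| * P s s' := fun s' => by
    rw [hv' s']
    refine (Finset.abs_sum_le_sum_abs _ _).trans_eq (Finset.sum_congr rfl fun s _ => ?_)
    rw [abs_mul, abs_of_nonneg (hP s s')]
  have hsum : ∑ s', |v s'| = ∑ s', ∑ s, |v s| * P s s' := by
    rw [Finset.sum_comm]
    simp [← Finset.mul_sum, hP1]
  have heq := (Finset.sum_eq_sum_iff_of_le fun s' _ => hle s').1 hsum
  have hpos : 0 < ∑ s, |v s| := by
    obtain ⟨s, hs⟩ := Function.ne_iff.1 hv0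
    exact Finset.sum_pos' (fun _ _ => abs_nonneg _) ⟨s, Finset.mem_univ _, abs_pos.2 hs⟩
  refine ⟨fun s => |v s| / ∑ s, |v s|, fun s => by positivity, ?_, ?_⟩
  · rw [← Finset.sum_div, div_self hpos.ne']
  · ext s'
    change ∑ s, |v s| / _ * P s s' = |v s'| / _
    rw [heq s' (Finset.mem_univ _), Finset.sum_div]
    exact Finset.sum_congr rfl fun s _ => by ring

/-- A stationary distribution of an irreducible matrix is positive. -/
theorem IsStationary.pos [DecidableEq S] {P : Matrix S S ℝ} {π : S → ℝ} (h : IsStationary P π)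
    (hP : P.IsIrreducible) (s : S) : 0 < π s := by
  have hpow : ∀ n : ℕ, π ᵥ* P ^ n = π := fun n => by
    induction n with
    | zero => simp
    | succ n ih => rw [pow_succ, ← Matrix.vecMul_vecMul, ih, h.2.2]
  obtain ⟨s₀, -, hs₀⟩ : ∃ s₀ ∈ Finset.univ, 0 < π s₀ := by
    refine Finset.exists_lt_of_sum_lt ?_
    simp [h.2.1]
  obtain ⟨n, -, hn⟩ := (Matrix.isIrreducible_iff_exists_pow_pos hP.nonneg).1 hP s₀ s
  rw [← hpow n]
  exact Finset.sum_pos' (fun i _ => mul_nonneg (h.1 i) (Matrix.pow_apply_nonneg hP.nonneg _ _ _))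
    ⟨s₀, Finset.mem_univ _, mul_pos hs₀ hn⟩

end Stationary

/-! ### Contraction of the oscillation and the Poisson equation -/

section Poisson

variable {S : Type*} [Fintype S]

lemma abs_sum_sub_sum_le_tvDist (p q : S → ℝ) (E : Finset S) :
    |∑ s ∈ E, p s - ∑ s ∈ E, q s| ≤ tvDist p q :=
  le_ciSup (f := fun E : Finset S => |∑ s ∈ E, p s - ∑ s ∈ E, q s|) (Set.finite_range _).bddAbove E

lemma tvDist_le_contraction (P : Matrix S S ℝ) (s s' : S) :
    tvDist (P s') (P s) ≤ contraction P :=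
  (le_ciSup (f := fun s' => tvDist (P s') (P s)) (Set.finite_range _).bddAbove s').trans
    (le_ciSup (f := fun s => ⨆ s', tvDist (P s') (P s)) (Set.finite_range _).bddAbove s)

/-- The expectations of a function of oscillation at most `K` under two distributions differ by at
most `K` times their total variation distance. -/
lemma sum_mul_sub_sum_mul_le [Nonempty S] {p q : S → ℝ} (hpq : ∑ s, p s = ∑ s, q s)
    {g : S → ℝ} {K : ℝ}
    (hg : ∀ s s', g s - g s' ≤ K) :
    ∑ s, p s * g s - ∑ s, q s * g s ≤ tvDist p q * K := by
  classical
  -- Equal masses allow `g` to be shifted by its minimum; afterwards only states with `q s ≤ p s`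
  -- can contribute positively.
  obtain ⟨s₀, hs₀⟩ := Finite.exists_min g
  set E : Finset S := Finset.univ.filter fun s => q s ≤ p s
  have hK : 0 ≤ K := by simpa using hg s₀ s₀
  calc ∑ s, p s * g s - ∑ s, q s * g s
      = ∑ s, (p s - q s) * (g s - g s₀) + (∑ s, p s - ∑ s, q s) * g s₀ := by
        rw [← Finset.sum_sub_distrib, ← Finset.sum_sub_distrib, Finset.sum_mul,
          ← Finset.sum_add_distrib]
        exact Finset.sum_congr rfl fun s _ => by ring
    _ = ∑ s, (p s - q s) * (g s - g s₀) := by rw [hpq]; ring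
    _ ≤ ∑ s ∈ E, (p s - q s) * K := by
        rw [Finset.sum_filter]
        refine Finset.sum_le_sum fun s _ => ?_
        split_ifs with h
        · exact mul_le_mul_of_nonneg_left (hg _ _) (sub_nonneg.2 h)
        · exact mul_nonpos_of_nonpos_of_nonneg (by linarith) (sub_nonneg.2 (hs₀ s))
    _ = (∑ s ∈ E, p s - ∑ s ∈ E, q s) * K := by
        rw [← Finset.sum_mul, Finset.sum_sub_distrib]
    _ ≤ tvDist p q * K :=
        mul_le_mul_of_nonneg_right ((le_abs_self _).trans (abs_sum_sub_sum_le_tvDist p q E)) hK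

lemma sum_mul_sub_le_contraction [Nonempty S] {P : Matrix S S ℝ} (hP1 : ∀ s, ∑ s', P s s' = 1)
    {g : S → ℝ} {K : ℝ} (hg : ∀ s s', g s - g s' ≤ K) (s s' : S) :
    ∑ i, P s i * g i - ∑ i, P s' i * g i ≤ contraction P * K :=
  (sum_mul_sub_sum_mul_le ((hP1 s).trans (hP1 s').symm) hg).trans
    (mul_le_mul_of_nonneg_right (tvDist_le_contraction P s' s) (by simpa using hg s s))

/-- If `h = r + P h - ρ` and `r` has oscillation at most `K`, then `h` has oscillation at most
`K / (1 - γ)`. -/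
lemma sub_le_div_of_poisson [Nonempty S] {P : Matrix S S ℝ} (hP1 : ∀ s, ∑ s', P s s' = 1)
    (hγ : contraction P < 1) {r h : S → ℝ} {ρ K : ℝ}
    (hh : ∀ s, r s + ∑ s', P s s' * h s' = ρ + h s) (hr : ∀ s s', r s - r s' ≤ K) (s s' : S) :
    h s - h s' ≤ K / (1 - contraction P) := by
  -- Comparing the equation at a maximum and a minimum of `h` gives `osc h ≤ K + γ osc h`.
  obtain ⟨a, ha⟩ := Finite.exists_max h
  obtain ⟨b, hb⟩ := Finite.exists_min h
  have h1 : ∀ s s', h s - h s' ≤ h a - h b := fun s s' => sub_le_sub (ha s) (hb s')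
  refine (h1 s s').trans ?_
  rw [le_div_iff₀ (by linarith)]
  have := sum_mul_sub_le_contraction hP1 h1 a b
  have := hh a
  have := hh b
  have := hr a b
  linarith

/-- The Poisson equation of a stochastic matrix with contraction coefficient less than `1`. -/
theorem exists_poisson [Nonempty S] {P : Matrix S S ℝ} (hP1 : ∀ s, ∑ s', P s s' = 1)
    (hγ : contraction P < 1) {π : S → ℝ} (hπ : IsStationary P π) (r : S → ℝ) :
    ∃ h : S → ℝ, ∀ s, r s + ∑ s', P s s' * h s' = ∑ s, π s * r s + h s := by
  -- `1 - P` is singular, so the rank-one term `h ↦ π h` is added. Integrating against `π` gives `π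
  -- (L h) = π h`; hence a kernel element is harmonic with mean zero, thus zero, and for `L h = r`
  -- the extra term is exactly the average reward.
  let L : (S → ℝ) →ₗ[ℝ] (S → ℝ) :=
    { toFun := fun h s => h s - ∑ s', P s s' * h s' + ∑ s', π s' * h s'
      map_add' := fun g h => by
        ext s
        simp only [Pi.add_apply, mul_add, Finset.sum_add_distrib]
        ring
      map_smul' := fun c h => by
        ext s
        simp only [Pi.smul_apply, smul_eq_mul, RingHom.id_apply, mul_left_comm _ c,
          ← Finset.mul_sum]
        ring }
  have hLπ : ∀ h, ∑ s, π s * L h s = ∑ s, π s * h s := fun h => by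
    change ∑ s, π s * (h s - ∑ s', P s s' * h s' + ∑ s', π s' * h s') = _
    simp only [mul_add, mul_sub, Finset.sum_add_distrib, Finset.sum_sub_distrib, hπ.sum_mul,
      ← Finset.sum_mul, hπ.2.1]
    ring
  have hinj : Function.Injective L := by
    refine (injective_iff_map_eq_zero L).2 fun h hh => ?_
    have h0 : ∑ s, π s * h s = 0 := by rw [← hLπ, hh]; simp
    have h1 : ∀ s, (0 : ℝ) + ∑ s', P s s' * h s' = 0 + h s := fun s => by
      have : h s - ∑ s', P s s' * h s' + ∑ s', π s' * h s' = 0 := congrFun hh s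
      linarith
    have h2 := sub_le_div_of_poisson hP1 hγ (r := fun _ => 0) (K := 0) h1 (by simp)
    ext s
    have h3 : ∀ s', h s' = h s := fun s' => by
      have := h2 s s'
      have := h2 s' s
      simp only [zero_div] at *
      linarith
    simp only [h3, ← Finset.sum_mul, hπ.2.1, one_mul] at h0
    exact h0
  obtain ⟨h, hh⟩ := LinearMap.injective_iff_surjective.1 hinj r
  refine ⟨h, fun s => ?_⟩
  have h1 : h s - ∑ s', P s s' * h s' + ∑ s', π s' * h s' = r s := congrFun hh s
  rw [← hh, hLπ, hh]
  linarith

end Poisson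

/-! ### The average reward linear program -/

section LP

variable {S A : Type*} [Fintype S] {𝓜 : MDP S A}

lemma MDP.chain_nonneg (β : 𝓜.Policy) (s s' : S) : 0 ≤ 𝓜.chain β s s' :=
  𝓜.trans_nonneg s _ (β s).2 s'

lemma MDP.chain_sum (β : 𝓜.Policy) (s : S) : ∑ s', 𝓜.chain β s s' = 1 :=
  𝓜.trans_sum s _ (β s).2

lemma MDP.isStationary_stationaryDist [Nonempty S] (β : 𝓜.Policy) :
    IsStationary (𝓜.chain β) (𝓜.stationaryDist β) := by
  classical
  exact Classical.epsilon_spec (exists_isStationary (MDP.chain_nonneg β) (MDP.chain_sum β))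

/-- Performance difference: if `h` solves the Poisson equation of `β` up to the value `ρ`, the
average reward of a policy is `ρ` plus the average of its advantages. -/
lemma MDP.sum_stationaryDist_mul [Nonempty S] (r : A → ℝ) (h : S → ℝ) (ρ : ℝ) (β : 𝓜.Policy) :
    ∑ s, 𝓜.stationaryDist β s * r (β s) = ρ + ∑ s, 𝓜.stationaryDist β s *
      (r (β s) + ∑ s', 𝓜.trans s (β s) s' * h s' - h s - ρ) := by
  have hst := MDP.isStationary_stationaryDist β
  have := hst.sum_mul h
  simp only [MDP.chain, Matrix.of_apply] at this
  simp only [mul_add, mul_sub, Finset.sum_add_distrib, Finset.sum_sub_distrib, this,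
    ← Finset.sum_mul, hst.2.1]
  ring

/-- If `β₀` is the only policy of maximal average reward, then it is strictly better than any other
action in the sense of the advantage function. -/
lemma MDP.advantage_neg [DecidableEq S] [Nonempty S] {r : A → ℝ} {h : S → ℝ} {β₀ : 𝓜.Policy}
    (hh : ∀ s, r (β₀ s) + ∑ s', 𝓜.trans s (β₀ s) s' * h s'
      = ∑ s, 𝓜.stationaryDist β₀ s * r (β₀ s) + h s)
    (hopt : ∀ β : 𝓜.Policy, β ≠ β₀ →
      ∑ s, 𝓜.stationaryDist β s * r (β s) < ∑ s, 𝓜.stationaryDist β₀ s * r (β₀ s))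
    {s : S} {a : A} (ha : a ∈ 𝓜.act s) (hne : a ≠ β₀ s) :
    r a + ∑ s', 𝓜.trans s a s' * h s' - h s - ∑ s, 𝓜.stationaryDist β₀ s * r (β₀ s) < 0 := by
  set ρ := ∑ s, 𝓜.stationaryDist β₀ s * r (β₀ s)
  -- Deviate from `β₀` in the single state `s`: all other advantages vanish, so the performance
  -- difference is the advantage of `a` weighted by a nonnegative stationary mass.
  let β : 𝓜.Policy := Function.update β₀ s ⟨a, ha⟩
  have hβs : β s = ⟨a, ha⟩ := Function.update_self ..
  have hβ : ∀ s', s' ≠ s → β s' = β₀ s' := fun s' hs' => Function.update_of_ne hs' ..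
  have hlt := hopt β fun hcon => hne <| by rw [← hcon, hβs]
  rw [MDP.sum_stationaryDist_mul r h ρ β, Finset.sum_eq_single_of_mem s (Finset.mem_univ _)
    fun s' _ hs' => by rw [hβ s' hs', hh s']; ring, hβs] at hlt
  have h0 := (MDP.isStationary_stationaryDist β).1 s
  by_contra! hcon
  have := mul_nonneg h0 hcon
  simp only at hlt
  linarith

/-- If `β₀` is the only policy of maximal average reward, then the LP yields `β₀`. -/
theorem MDP.IsLPPolicy.eq_of_unique [DecidableEq S] [Nonempty S] {r : A → ℝ} {β₀ β : 𝓜.Policy}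
    (hirr : (𝓜.chain β₀).IsIrreducible) (hγ : contraction (𝓜.chain β₀) < 1)
    (hopt : ∀ β : 𝓜.Policy, β ≠ β₀ →
      ∑ s, 𝓜.stationaryDist β s * r (β s) < ∑ s, 𝓜.stationaryDist β₀ s * r (β₀ s))
    (hβ : 𝓜.IsLPPolicy r β) : β = β₀ := by
  classical
  obtain ⟨π, ⟨⟨hnn, hsum, hbal⟩, hmax⟩, harg⟩ := hβ
  have hst := MDP.isStationary_stationaryDist β₀
  obtain ⟨h, hh⟩ := exists_poisson (MDP.chain_sum β₀) hγ hst fun s => r (β₀ s)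
  simp only [MDP.chain, Matrix.of_apply] at hh
  set ρ := ∑ s, 𝓜.stationaryDist β₀ s * r (β₀ s) with hρ
  set adv : S → A → ℝ := fun s a => r a + ∑ s', 𝓜.trans s a s' * h s' - h s - ρ with hadv
  have hadv_neg : ∀ s, ∀ a ∈ 𝓜.act s, a ≠ β₀ s → adv s a < 0 := fun s a ha hne =>
    MDP.advantage_neg hh hopt ha hne
  have hadv_zero : ∀ s, adv s (β₀ s) = 0 := fun s => by simp only [hadv, hh]; ring
  -- The balance constraints cancel the `h` terms, so the value exceeds `ρ` only through advantages,
  -- none of which is positive.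
  have hval : 𝓜.lpValue r π = ρ + ∑ s, ∑ a ∈ 𝓜.act s, π s a * adv s a := by
    have h1 : ∑ s, ∑ a ∈ 𝓜.act s, π s a * ∑ s', 𝓜.trans s a s' * h s'
        = ∑ s, ∑ a ∈ 𝓜.act s, π s a * h s := by
      simp only [← Finset.sum_mul, hbal]
      simp only [Finset.sum_mul, Finset.mul_sum]
      rw [Finset.sum_comm]
      simp only [Finset.sum_comm (s := Finset.univ) (t := 𝓜.act _)]
      exact Finset.sum_congr rfl fun s _ => Finset.sum_congr rfl fun a _ =>
        Finset.sum_congr rfl fun s' _ => by ring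
    simp only [hadv, mul_add, mul_sub, Finset.sum_add_distrib, Finset.sum_sub_distrib, h1]
    have h2 : ∑ s, ∑ a ∈ 𝓜.act s, π s a * ρ = ρ := by
      simp only [← Finset.sum_mul, hsum, one_mul]
    rw [h2]
    simp only [MDP.lpValue]
    ring
  have hfeas : 𝓜.LPFeasible fun s a => if a = β₀ s then 𝓜.stationaryDist β₀ s else 0 := by
    refine ⟨fun s a _ => ?_, ?_, fun s' => ?_⟩
    · dsimp only
      split_ifs
      exacts [hst.1 s, le_rfl]
    · simp [hst.2.1]
    · have := congrFun hst.2.2 s'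
      simp only [Matrix.vecMul, dotProduct, MDP.chain, Matrix.of_apply] at this
      simp [ite_mul, this]
  have hle : ρ ≤ 𝓜.lpValue r π := by
    refine le_trans (le_of_eq ?_) (hmax _ hfeas)
    simp [MDP.lpValue, ite_mul, hρ]
  have hterm : ∀ s, ∀ a ∈ 𝓜.act s, π s a * adv s a ≤ 0 := fun s a ha => by
    by_cases hne : a = β₀ s
    · rw [hne, hadv_zero, mul_zero]
    · exact mul_nonpos_of_nonneg_of_nonpos (hnn s a ha) (hadv_neg s a ha hne).le
  have hzero : ∑ s, ∑ a ∈ 𝓜.act s, π s a * adv s a = 0 :=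
    le_antisymm (Finset.sum_nonpos fun s _ => Finset.sum_nonpos (hterm s)) (by linarith)
  have hsupp : ∀ s, ∀ a ∈ 𝓜.act s, a ≠ β₀ s → π s a = 0 := fun s a ha hne => by
    have h1 := (Finset.sum_eq_zero_iff_of_nonpos fun s _ => Finset.sum_nonpos (hterm s)).1 hzero s
      (Finset.mem_univ _)
    have h2 := (Finset.sum_eq_zero_iff_of_nonpos (hterm s)).1 h1 a ha
    exact (mul_eq_zero.1 h2).resolve_right (hadv_neg s a ha hne).ne
  have hsingle : ∀ s (g : A → ℝ), ∑ a ∈ 𝓜.act s, π s a * g a = π s (β₀ s) * g (β₀ s) := fun s g =>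
    Finset.sum_eq_single_of_mem _ (β₀ s).2 fun a ha hne => by rw [hsupp s a ha hne, zero_mul]
  have hsingle' : ∀ s, ∑ a ∈ 𝓜.act s, π s a = π s (β₀ s) := fun s => by
    simpa using hsingle s 1
  -- With `π` concentrated on `β₀`, its state marginal is stationary. Positivity in every state is
  -- what prevents a tie among zeros in the argmax.
  have hstat : IsStationary (𝓜.chain β₀) fun s => π s (β₀ s) := by
    refine ⟨fun s => hnn s _ (β₀ s).2, by simpa only [hsingle'] using hsum, ?_⟩
    ext s'
    have := hbal s'
    rw [hsingle'] at this
    rw [this]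
    exact (Finset.sum_congr rfl fun s _ => hsingle s fun a => 𝓜.trans s a s').symm
  funext s
  by_contra hne
  have h1 := hsupp s (β s) (β s).2 fun h => hne (Subtype.ext h)
  have h2 := harg s (β₀ s) (β₀ s).2
  have h3 := hstat.pos hirr s
  linarith

end LP

/-! ### Exploration sequences -/

section Exploration

variable {M : ℕ} {w : ℝ} {R : Set ℕ}

lemma ncard_inter_Icc_succ_of_mem {t : ℕ} (h : t + 1 ∈ R) :
    (R ∩ Set.Icc 1 (t + 1)).ncard = (R ∩ Set.Icc 1 t).ncard + 1 := by
  have : R ∩ Set.Icc 1 (t + 1) = insert (t + 1) (R ∩ Set.Icc 1 t) := by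
    ext i
    simp only [Set.mem_inter_iff, Set.mem_Icc, Set.mem_insert_iff]
    constructor
    · rintro ⟨h1, h2, h3⟩
      rcases h3.eq_or_lt with h4 | h4
      · exact Or.inl h4
      · exact Or.inr ⟨h1, h2, by omega⟩
    · rintro (rfl | ⟨h1, h2, h3⟩)
      · exact ⟨h, by omega, le_rfl⟩
      · exact ⟨h1, h2, by omega⟩
  rw [this, Set.ncard_insert_of_notMem (by simp) ((Set.finite_Icc 1 t).inter_of_right R)]

lemma ncard_inter_Icc_succ_of_notMem {t : ℕ} (h : t + 1 ∉ R) :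
    (R ∩ Set.Icc 1 (t + 1)).ncard = (R ∩ Set.Icc 1 t).ncard := by
  congr 1
  ext i
  simp only [Set.mem_inter_iff, Set.mem_Icc]
  refine and_congr_right fun h1 => ⟨fun ⟨h2, h3⟩ => ⟨h2, ?_⟩, fun ⟨h2, h3⟩ => ⟨h2, by omega⟩⟩
  have : i ≠ t + 1 := fun h4 => h (h4 ▸ h1)
  omega

lemma one_le_ceil_mul_log (hw : 0 < w) {t : ℕ} (ht : 2 ≤ t) : 1 ≤ ⌈w * Real.log t⌉ :=
  Int.one_le_ceil_iff.2 (mul_pos hw (Real.log_pos (by exact_mod_cast ht)))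

lemma ceil_mul_log_mono (hw : 0 < w) {s t : ℕ} (hs : 1 ≤ s) (hst : s ≤ t) :
    ⌈w * Real.log s⌉ ≤ ⌈w * Real.log t⌉ := by
  have : (0 : ℝ) < s := by exact_mod_cast hs
  gcongr

/-- A slot is explored only while the count is strictly below the quota, so the count cannot
overshoot it. Slot 1 is left out: the rule does not govern it, and the quota at `T = 1` is zero. -/
lemma IsExplorationSequence.card_filter_le [DecidablePred (· ∈ R)] (hR : IsExplorationSequence M w R)
    (hw : 0 < w) {T : ℕ} (hT : 1 ≤ T) :
    (((Finset.Icc 2 T).filter (· ∈ R)).card : ℤ) ≤ M * ⌈w * Real.log T⌉ := by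
  induction T, hT using Nat.le_induction with
  | base => simp
  | succ t ht ih =>
    have hmono := ceil_mul_log_mono hw ht t.le_succ
    rw [← Finset.insert_Icc_right_eq_Icc_add_one (by omega), Finset.filter_insert]
    split_ifs with h
    · have h1 := (hR.2 (t + 1) (by omega)).1 h
      rw [Nat.add_sub_cancel] at h1
      have h2 : ((Finset.Icc 2 t).filter (· ∈ R)).card ≤ (R ∩ Set.Icc 1 t).ncard := by
        rw [← Set.ncard_coe_finset]
        refine Set.ncard_le_ncard (fun i hi => ?_) ((Set.finite_Icc 1 t).inter_of_right R)
        simp only [Finset.coe_filter, Finset.mem_Icc, Set.mem_ofPred_eq] at hi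
        exact ⟨hi.2, by omega, hi.1.2⟩
      have h3 := Finset.card_insert_le (t + 1) ((Finset.Icc 2 t).filter (· ∈ R))
      omega
    · exact ih.trans (mul_le_mul_of_nonneg_left hmono (by positivity))

variable [NeZero M]

lemma exists_roundRobin_eq (s : ℕ) (j : Fin M) :
    ∃ i, s < i ∧ i ≤ s + M ∧ roundRobin M i = j := by
  have hM : 0 < M := Nat.pos_of_neZero M
  have hs := Nat.mod_lt s hM
  -- The offset is `j - s` modulo `M`; the final `+ 1` undoes the `n - 1` in `roundRobin`.
  refine ⟨s + (j + (M - s % M)) % M + 1, by omega, ?_, ?_⟩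
  · have := Nat.mod_lt (j + (M - s % M)) hM
    omega
  · ext
    change (s + (j + (M - s % M)) % M + 1 - 1) % M = j
    rw [Nat.add_sub_cancel, Nat.add_mod_mod, ← Nat.mod_add_mod,
      show s % M + (j + (M - s % M)) = j + M by omega, Nat.add_mod_right, Nat.mod_eq_of_lt j.2]

lemma exploreCount_mono (j : Fin M) : Monotone fun n => exploreCount R n j :=
  monotone_nat_of_le_succ fun n => by
    rw [exploreCount]
    split_ifs <;> omega

/-- In a block of `M` consecutive exploration slots every channel is explored. -/
lemma exploreCount_add_le {s : ℕ} (hs : ∀ i, s < i → i ≤ s + M → i ∈ R) (j : Fin M) :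
    exploreCount R s j + 1 ≤ exploreCount R (s + M) j := by
  obtain ⟨i, h1, h2, h3⟩ := exists_roundRobin_eq s j
  obtain ⟨i, rfl⟩ : ∃ k, i = k + 1 := ⟨i - 1, by omega⟩
  calc exploreCount R s j + 1 ≤ exploreCount R i j + 1 :=
        Nat.add_le_add_right (exploreCount_mono j (by omega)) 1
    _ = exploreCount R (i + 1) j := by
        rw [exploreCount, if_pos ⟨hs _ h1 h2, h3⟩]
    _ ≤ _ := exploreCount_mono j h2

/-- Exploration proceeds in blocks of `M` consecutive slots: `s` is the end of the last complete block
before slot `t` (or `t` itself), `q` the number of complete blocks. -/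
lemma IsExplorationSequence.exists_block (hR : IsExplorationSequence M w R) (hw : 0 < w) (t : ℕ) :
    ∃ s q : ℕ, s ≤ t ∧ t < s + M ∧ (R ∩ Set.Icc 1 t).ncard = M * q + (t - s) ∧
      (∀ i, s < i → i ≤ t → i ∈ R) ∧ (∀ j : Fin M, q ≤ exploreCount R s j) ∧
      (s < t → (q : ℤ) < ⌈w * Real.log (t + 1 : ℕ)⌉) := by
  have hM : 0 < M := Nat.pos_of_neZero M
  have hM' : (0 : ℤ) < M := by exact_mod_cast hM
  induction t with
  | zero => exact ⟨0, 0, le_rfl, by omega, by simp, by omega, by simp, by omega⟩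
  | succ t ih =>
    obtain ⟨s, q, hst, htM, hcard, hmem, hcount, hceil⟩ := ih
    by_cases ht : t + 1 ∈ R
    · have hmem' : ∀ i, s < i → i ≤ t + 1 → i ∈ R := fun i h1 h2 => by
        rcases h2.eq_or_lt with h3 | h3
        · rwa [h3]
        · exact hmem i h1 (by omega)
      rw [ncard_inter_Icc_succ_of_mem ht, hcard]
      by_cases hfull : t + 1 = s + M
      · refine ⟨t + 1, q + 1, le_rfl, by omega, ?_, by omega, fun j => ?_, by omega⟩
        · rw [Nat.mul_succ]
          omega
        · rw [hfull] at hmem' ⊢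
          exact (Nat.succ_le_succ (hcount j)).trans (exploreCount_add_le hmem' j)
      · refine ⟨s, q, by omega, by omega, by omega, hmem', hcount, fun _ => ?_⟩
        have hmono := ceil_mul_log_mono hw (Nat.succ_pos t) (Nat.le_succ (t + 1))
        rcases hst.lt_or_eq with h | rfl
        · exact (hceil h).trans_le hmono
        · rw [Nat.sub_self, add_zero] at hcard
          -- A block starting at slot 1 is not governed by the rule, but the quota at slot 2 is
          -- already positive.
          rcases s.eq_zero_or_pos with rfl | hs
          · have hq : q = 0 := by simpa [hM.ne'] using hcard
            have := one_le_ceil_mul_log hw (le_refl 2)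
            simp only [hq]
            exact_mod_cast this
          · refine lt_of_lt_of_le ?_ hmono
            have h1 := (hR.2 (s + 1) (by omega)).1 ht
            rw [Nat.add_sub_cancel, hcard] at h1
            push_cast at h1 ⊢
            exact lt_of_mul_lt_mul_left h1 hM'.le
    · rcases hst.lt_or_eq with h | rfl
      · have h1 := mt (hR.2 (t + 1) (by omega)).2 ht
        rw [Nat.add_sub_cancel, hcard, not_lt] at h1
        push_cast at h1
        have h2 : (M : ℤ) * ⌈w * Real.log (t + 1 : ℕ)⌉ < M * (q + 1) := by
          push_cast
          rw [mul_add]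
          omega
        have h3 := lt_of_mul_lt_mul_left h2 hM'.le
        have h4 := hceil h
        omega
      · refine ⟨s + 1, q, le_rfl, by omega, ?_, by omega,
          fun j => (hcount j).trans (exploreCount_mono j s.le_succ), by omega⟩
        rw [ncard_inter_Icc_succ_of_notMem ht, hcard]
        simp

/-- When slot `n` is not an exploration slot, every channel has been explored `⌈w ln n⌉` times. -/
lemma IsExplorationSequence.ceil_le_exploreCount (hR : IsExplorationSequence M w R) (hw : 0 < w)
    {n : ℕ} (hn : 2 ≤ n) (hnR : n ∉ R) (j : Fin M) :
    ⌈w * Real.log n⌉ ≤ exploreCount R (n - 1) j := by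
  have hM : (0 : ℤ) < M := by exact_mod_cast Nat.pos_of_neZero M
  obtain ⟨s, q, hst, htM, hcard, -, hcount, -⟩ := hR.exists_block hw (n - 1)
  have h1 := mt (hR.2 n (by omega)).2 hnR
  rw [hcard, not_lt] at h1
  have h2 : (M : ℤ) * ⌈w * Real.log n⌉ < M * (q + 1) := by
    rw [mul_add]
    push_cast at h1
    omega
  have h3 := lt_of_mul_lt_mul_left h2 hM.le
  have h4 := (hcount j).trans (exploreCount_mono j hst)
  simp only at h4
  omega

end Exploration

/-! ### Concentration of the estimates -/

section Concentration

lemma sub_iInf_le_rateRange {A 𝒳 : Type*} [Finite A] {f : A → 𝒳 → ℝ}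
    (hf : ∀ a, BddAbove (Set.range (f a))) (a : A) (x : 𝒳) :
    f a x - ⨅ x, f a x ≤ rateRange f :=
  (sub_le_sub_right (le_ciSup (hf a) x) _).trans
    (le_ciSup (f := fun a => (⨆ x, f a x) - ⨅ x, f a x) (Set.finite_range _).bddAbove a)

variable {S A 𝒳 Ω : Type*} [Fintype S] [MeasurableSpace 𝒳] {mΩ : MeasurableSpace Ω}
  {Pr : Measure Ω} {M : ℕ} {𝓜 : MDP S A} {f : A → 𝒳 → ℝ} {ν : Fin M → Measure 𝒳} {R : Set ℕ}
  {ℱ : Filtration ℕ mΩ} {X : ℕ → Ω → Fin M → 𝒳} {st : ℕ → Ω → S} {ac : ℕ → Ω → A}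
  {ch : ℕ → Ω → Fin M}

lemma IsControlledSystem.measurable_gain (hsys : IsControlledSystem 𝓜 ν Pr ℱ X st ac ch) {n : ℕ}
    (hn : 1 ≤ n) (j : Fin M) : Measurable fun ω => X n ω j :=
  (measurable_pi_apply j).comp ((hsys.gain_observed n hn).mono (ℱ.le _) le_rfl)

lemma IsControlledSystem.integral_rate (hsys : IsControlledSystem 𝓜 ν Pr ℱ X st ac ch)
    (hf_meas : ∀ a, Measurable (f a)) {n : ℕ} (hn : 1 ≤ n) (j : Fin M) (a : A) :
    ∫ ω, f a (X n ω j) ∂Pr = meanRate f ν j a := by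
  rw [meanRate, ← hsys.gain_law n hn j,
    integral_map (hsys.measurable_gain hn j).aemeasurable (hf_meas a).aestronglyMeasurable]

/-- The gains of a slot are independent of any variable known when its decision is taken. -/
lemma IsControlledSystem.indepFun_rate (hsys : IsControlledSystem 𝓜 ν Pr ℱ X st ac ch)
    (hf_meas : ∀ a, Measurable (f a)) {n : ℕ} (hn : 1 ≤ n) (j : Fin M) (a : A) {Y : Ω → ℝ}
    (hY : Measurable[ℱ n] Y) : Y ⟂ᵢ[Pr] fun ω => f a (X n ω j) := by
  refine (IndepFun_iff_Indep ..).2 (indep_of_indep_of_le (hsys.gain_indep n hn).symm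
    hY.comap_le ?_)
  have : (fun ω => f a (X n ω j)) = (fun x : Fin M → 𝒳 => f a (x j)) ∘ X n := rfl
  rw [this, ← MeasurableSpace.comap_comp]
  exact MeasurableSpace.comap_mono ((hf_meas a).comp (measurable_pi_apply j)).comap_le

lemma IsControlledSystem.measurable_estimate [NeZero M]
    (hsys : IsControlledSystem 𝓜 ν Pr ℱ X st ac ch)
    (hf_meas : ∀ a, Measurable (f a)) (n : ℕ) (j : Fin M) (a : A) :
    Measurable[ℱ (n + 1)] fun ω => estimate f R (fun k => X k ω) n j a := by
  induction n with
  | zero => exact measurable_const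
  | succ n ih =>
    have ih' := ih.mono (ℱ.mono (Nat.le_succ (n + 1))) le_rfl
    have h1 : Measurable[ℱ (n + 1 + 1)] fun ω => f a (X (n + 1) ω j) :=
      (hf_meas a).comp ((measurable_pi_apply j).comp (hsys.gain_observed (n + 1) (by omega)))
    simp only [estimate]
    split_ifs
    · exact ((ih'.const_mul _).add h1).div_const _
    · exact ih'

/-- The centred sum of the observed rates of a channel is sub-Gaussian. -/
lemma IsControlledSystem.hasSubgaussianMGF [NeZero M] [Finite A] [IsProbabilityMeasure Pr]
    (hsys : IsControlledSystem 𝓜 ν Pr ℱ X st ac ch)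
    (hf_meas : ∀ a, Measurable (f a)) (hf_nonneg : ∀ a x, 0 ≤ f a x)
    (hf_bdd : ∀ a, BddAbove (Set.range (f a))) (n : ℕ) (j : Fin M) (a : A) :
    HasSubgaussianMGF (fun ω => (exploreCount R n j : ℝ) *
      (estimate f R (fun k => X k ω) n j a - meanRate f ν j a))
      (exploreCount R n j * (‖rateRange f‖₊ / 2) ^ 2) Pr := by
  induction n with
  | zero => simp [exploreCount, HasSubgaussianMGF.fun_zero]
  | succ n ih =>
    by_cases hn : n + 1 ∈ R ∧ roundRobin M (n + 1) = j
    · have hX : HasSubgaussianMGF (fun ω => f a (X (n + 1) ω j) - meanRate f ν j a)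
          ((‖rateRange f‖₊ / 2) ^ 2) Pr := by
        have h1 := hasSubgaussianMGF_of_mem_Icc (μ := Pr)
          (X := fun ω => f a (X (n + 1) ω j)) (a := ⨅ x, f a x)
          (b := (⨅ x, f a x) + rateRange f)
          ((hf_meas a).comp (hsys.measurable_gain (by omega) j)).aemeasurable
          (ae_of_all _ fun ω => ⟨ciInf_le ⟨0, by rintro _ ⟨x, rfl⟩; exact hf_nonneg a x⟩ _, by
            have := sub_iInf_le_rateRange hf_bdd a (X (n + 1) ω j)
            linarith⟩)
        rwa [add_sub_cancel_left, hsys.integral_rate hf_meas (by omega)] at h1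
      -- The estimate after slot `n` is known at slot `n + 1`, hence independent of the new gain.
      -- Since `R` is not random, count times error is a sum with a deterministic number of centred
      -- rates, and variance proxies add.
      have hind : (fun ω => (exploreCount R n j : ℝ) *
          (estimate f R (fun k => X k ω) n j a - meanRate f ν j a)) ⟂ᵢ[Pr]
          fun ω => f a (X (n + 1) ω j) - meanRate f ν j a :=
        (hsys.indepFun_rate hf_meas (by omega) j a
          (((hsys.measurable_estimate hf_meas n j a).sub_const _).const_mul _)).comp
          measurable_id (measurable_id.sub_const _)
      convert ih.add_of_indepFun hX hind using 1
      · ext ω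
        simp only [exploreCount, estimate, if_pos hn]
        push_cast
        field_simp
        ring
      · simp only [exploreCount, if_pos hn]
        push_cast
        ring
    · simpa only [exploreCount, estimate, if_neg hn] using ih

/-- Hoeffding's inequality for the estimates. -/
lemma IsControlledSystem.measureReal_abs_estimate_sub_ge [NeZero M] [Finite A]
    [IsProbabilityMeasure Pr] (hsys : IsControlledSystem 𝓜 ν Pr ℱ X st ac ch)
    (hf_meas : ∀ a, Measurable (f a)) (hf_nonneg : ∀ a x, 0 ≤ f a x)
    (hf_bdd : ∀ a, BddAbove (Set.range (f a))) {n : ℕ} {j : Fin M} (a : A)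
    (hn : 0 < exploreCount R n j) {ε : ℝ} (hε : 0 ≤ ε) :
    Pr.real {ω | ε ≤ |estimate f R (fun k => X k ω) n j a - meanRate f ν j a|} ≤
      2 * Real.exp (-(exploreCount R n j * (2 * ε ^ 2 / rateRange f ^ 2))) := by
  have hN : (0 : ℝ) < exploreCount R n j := by exact_mod_cast hn
  have hsub := hsys.hasSubgaussianMGF (R := R) hf_meas hf_nonneg hf_bdd n j a
  have h1 := hsub.measure_ge_le (mul_nonneg hN.le hε)
  have h2 := hsub.neg.measure_ge_le (mul_nonneg hN.le hε)
  have hexp : -(exploreCount R n j * ε) ^ 2 /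
      (2 * ((exploreCount R n j * (‖rateRange f‖₊ / 2) ^ 2 : NNReal) : ℝ)) =
      -(exploreCount R n j * (2 * ε ^ 2 / rateRange f ^ 2)) := by
    push_cast
    rw [div_pow, Real.norm_eq_abs, sq_abs]
    rcases eq_or_ne (rateRange f) 0 with h0 | h0
    · simp [h0]
    · field_simp
  rw [hexp] at h1 h2
  refine (measureReal_mono fun ω hω => ?_).trans
    ((measureReal_union_le _ _).trans ((add_le_add h1 h2).trans_eq (two_mul _).symm))
  rcases le_abs'.1 (show ε ≤ |_| from hω) with h | h
  · right
    rw [Set.mem_ofPred_eq, Pi.neg_apply, ← mul_neg]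
    exact mul_le_mul_of_nonneg_left (by linarith) hN.le
  · left
    exact mul_le_mul_of_nonneg_left h hN.le

/-- In an exploitation slot `n` some estimate is off by `d / 2` with probability at most
`2 A M n ^ (-w d² / (2 B₀²))`. -/
lemma IsControlledSystem.measureReal_exists_abs_estimate_sub_ge [NeZero M] [Fintype A]
    [IsProbabilityMeasure Pr] (hsys : IsControlledSystem 𝓜 ν Pr ℱ X st ac ch)
    (hf_meas : ∀ a, Measurable (f a)) (hf_nonneg : ∀ a x, 0 ≤ f a x)
    (hf_bdd : ∀ a, BddAbove (Set.range (f a))) {w d : ℝ} (hw : 0 < w) (hd : 0 ≤ d)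
    (hR : IsExplorationSequence M w R) {n : ℕ} (hn : 2 ≤ n) (hnR : n ∉ R) :
    Pr.real {ω | ∃ a j, d / 2 ≤
        |estimate f R (fun k => X k ω) (n - 1) j a - meanRate f ν j a|} ≤
      2 * Fintype.card A * M * (n : ℝ) ^ (-(w * d ^ 2 / (2 * rateRange f ^ 2))) := by
  have hn0 : (0 : ℝ) < n := by exact_mod_cast (by omega : 0 < n)
  have hpt : ∀ p : A × Fin M, Pr.real {ω | d / 2 ≤
      |estimate f R (fun k => X k ω) (n - 1) p.2 p.1 - meanRate f ν p.2 p.1|} ≤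
      2 * (n : ℝ) ^ (-(w * d ^ 2 / (2 * rateRange f ^ 2))) := fun p => by
    have h1 := hR.ceil_le_exploreCount hw hn hnR p.2
    have h2 := one_le_ceil_mul_log hw hn
    refine (hsys.measureReal_abs_estimate_sub_ge hf_meas hf_nonneg hf_bdd p.1 (by omega)
      (by positivity)).trans ?_
    -- At accuracy `d / 2`, this many samples turn the Hoeffding exponential into a power of `n`.
    have h3 : w * Real.log n ≤ exploreCount R (n - 1) p.2 := Int.ceil_le.1 h1
    have h4 : 0 ≤ 2 * (d / 2) ^ 2 / rateRange f ^ 2 := by positivity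
    rw [Real.rpow_def_of_pos hn0]
    refine mul_le_mul_of_nonneg_left (Real.exp_le_exp.2 ?_) two_pos.le
    have h5 := mul_le_mul_of_nonneg_right h3 h4
    have h6 : Real.log n * -(w * d ^ 2 / (2 * rateRange f ^ 2)) =
        -(w * Real.log n * (2 * (d / 2) ^ 2 / rateRange f ^ 2)) := by ring
    linarith
  calc _ ≤ Pr.real (⋃ p : A × Fin M, {ω | d / 2 ≤
          |estimate f R (fun k => X k ω) (n - 1) p.2 p.1 - meanRate f ν p.2 p.1|}) :=
        by
        refine measureReal_mono fun ω hω => ?_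
        obtain ⟨a, j, h⟩ := hω
        exact Set.mem_iUnion.2 ⟨(a, j), h⟩
    _ ≤ ∑ p : A × Fin M, 2 * (n : ℝ) ^ (-(w * d ^ 2 / (2 * rateRange f ^ 2))) :=
        (measureReal_iUnion_fintype_le _).trans (Finset.sum_le_sum fun p _ => hpt p)
    _ = _ := by
        simp only [Finset.sum_const, Finset.card_univ, Fintype.card_prod, Fintype.card_fin,
          nsmul_eq_mul]
        push_cast
        ring

end Concentration

/-! ### Correctness of the learned policies -/

section Policies

variable {S A : Type*} [Fintype S] {M : ℕ} [NeZero M] {𝓜 : MDP S A} {m : Fin M → A → ℝ}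

lemma le_bestRate (m : Fin M → A → ℝ) (j : Fin M) (a : A) : m j a ≤ bestRate m a :=
  (Finite.exists_max fun j => m j a).choose_spec j

lemma le_sub_of_le_delta3 {d : ℝ} (hd : (d : EReal) ≤ delta3 m) {a : A} {j : Fin M}
    (h : m j a < bestRate m a) : d ≤ bestRate m a - m j a := by
  have : delta3 m ≤ ((bestRate m a - m j a : ℝ) : EReal) :=
    (iInf_le _ a).trans ((iInf_le _ j).trans (iInf_le _ h))
  exact_mod_cast hd.trans this

lemma le_sub_of_le_delta4 [Finite A] {d : ℝ} (hd : (d : EReal) ≤ 𝓜.delta4 m) {β : 𝓜.Policy}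
    (h : β ≠ 𝓜.bestPolicy m) : d ≤ 𝓜.optRate m - 𝓜.avgRate m β (bestChannel m) := by
  have : 𝓜.delta4 m ≤ ((𝓜.optRate m - 𝓜.avgRate m β (bestChannel m) : ℝ) : EReal) :=
    (iInf_le _ β).trans (iInf_le _ h)
  exact_mod_cast hd.trans this

/-- If the estimates `θ` are off by less than `d / 2`, the empirically best channels are best. -/
lemma eq_bestRate_of_abs_sub_lt {d : ℝ} (hd : (d : EReal) ≤ delta3 m) {θ : Fin M → A → ℝ}
    (hθ : ∀ a j, |θ j a - m j a| < d / 2) {φ : A → Fin M} (hφ : ∀ a j, θ j a ≤ θ (φ a) a) (a : A) :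
    m (φ a) a = bestRate m a := by
  by_contra hne
  have h1 := le_sub_of_le_delta3 hd (lt_of_le_of_ne (le_bestRate m (φ a) a) hne)
  have h2 := abs_lt.1 (hθ a (φ a))
  have h3 := abs_lt.1 (hθ a (bestChannel m a))
  have h4 := hφ a (bestChannel m a)
  rw [bestRate] at h1
  linarith [h2.1, h2.2, h3.1, h3.2]

/-- If the estimates `θ` are off by less than `d / 2`, the LP yields the optimal policy. -/
lemma eq_bestPolicy_of_abs_sub_lt [Finite A] [DecidableEq S] [Nonempty S]
    (hergodic : 𝓜.IsErgodic) (hγ : 𝓜.gamma m < 1) {d : ℝ} (hd : (d : EReal) ≤ 𝓜.delta4 m) {r : A → ℝ}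
    (hr : ∀ a, |r a - bestRate m a| < d / 2) {β : 𝓜.Policy} (hβ : 𝓜.IsLPPolicy r β) :
    β = 𝓜.bestPolicy m := by
  -- Each average moves by strictly less than `d / 2`, while `β*` leads every other policy by at
  -- least `d`.
  refine hβ.eq_of_unique (hergodic _).1 hγ fun β' hβ' => ?_
  have hclose : ∀ β : 𝓜.Policy,
      |∑ s, 𝓜.stationaryDist β s * r (β s) - 𝓜.avgRate m β (bestChannel m)| < d / 2 := fun β => by
    have hst := MDP.isStationary_stationaryDist β
    calc |∑ s, 𝓜.stationaryDist β s * r (β s) - 𝓜.avgRate m β (bestChannel m)|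
        = |∑ s, 𝓜.stationaryDist β s * (r (β s) - bestRate m (β s))| := by
          rw [MDP.avgRate, ← Finset.sum_sub_distrib]
          simp only [mul_sub]
          rfl
      _ ≤ ∑ s, 𝓜.stationaryDist β s * |r (β s) - bestRate m (β s)| := by
          refine (Finset.abs_sum_le_sum_abs _ _).trans_eq (Finset.sum_congr rfl fun s _ => ?_)
          rw [abs_mul, abs_of_nonneg (hst.1 s)]
      _ < ∑ s, 𝓜.stationaryDist β s * (d / 2) :=
          Finset.sum_lt_sum_of_nonempty Finset.univ_nonempty fun s _ =>
            mul_lt_mul_of_pos_left (hr _) (hst.pos (hergodic β).1 s)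
      _ = d / 2 := by rw [← Finset.sum_mul, hst.2.1, one_mul]
  have h1 := abs_lt.1 (hclose β')
  have h2 := abs_lt.1 (hclose (𝓜.bestPolicy m))
  have h3 := le_sub_of_le_delta4 hd hβ'
  rw [MDP.optRate] at h3
  linarith [h1.1, h1.2, h2.1, h2.2]

variable {𝒳 Ω : Type*} {mΩ : MeasurableSpace Ω} {f : A → 𝒳 → ℝ} {R : Set ℕ} {ℱ : Filtration ℕ mΩ}
  {X : ℕ → Ω → Fin M → 𝒳} {st : ℕ → Ω → S} {ac : ℕ → Ω → A} {ch : ℕ → Ω → Fin M}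
  {β : ℕ → Ω → 𝓜.Policy} {φ : ℕ → Ω → A → Fin M}

/-- In every exploitation slot `n ≥ 2` the policies in force are computed from the current
estimates. -/
lemma IsMCLPSM.policies_in_force (halg : IsMCLPSM 𝓜 f R ℱ X st ac ch β φ) {w : ℝ} (hw : 0 < w)
    (hR : IsExplorationSequence M w R) {n : ℕ} (hn : 2 ≤ n) (hnR : n ∉ R) (ω : Ω) :
    (∀ a j, estimate f R (fun k => X k ω) (n - 1) j a
      ≤ estimate f R (fun k => X k ω) (n - 1) (φ n ω a) a) ∧
    𝓜.IsLPPolicy (fun a => estimate f R (fun k => X k ω) (n - 1) (φ n ω a) a) (β n ω) := by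
  induction n, hn using Nat.le_induction with
  | base =>
    -- Were slot 1 not explored, the count before slot 2 would be zero, below its positive quota,
    -- forcing slot 2 into `R`.
    have h1 : 1 ∈ R := by
      by_contra h1
      refine hnR ((hR.2 2 one_lt_two).2 ?_)
      rw [show 2 - 1 = 0 + 1 from rfl, ncard_inter_Icc_succ_of_notMem h1]
      have hM : (0 : ℤ) < M := by exact_mod_cast Nat.pos_of_neZero M
      have := mul_pos hM (zero_lt_one.trans_le (one_le_ceil_mul_log hw le_rfl))
      simpa using this
    exact ⟨halg.mapping_update 2 le_rfl hnR h1 ω, halg.policy_update 2 le_rfl hnR h1 ω⟩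
  | succ n hn ih =>
    by_cases h : n ∈ R
    · exact ⟨halg.mapping_update (n + 1) (by omega) hnR h ω,
        halg.policy_update (n + 1) (by omega) hnR h ω⟩
    -- Estimates are frozen outside `R`, so the kept policies still fit the current ones.
    · obtain ⟨h1, h2⟩ := halg.keep (n + 1) (by omega) hnR h ω
      obtain ⟨k, rfl⟩ : ∃ k, n = k + 1 := ⟨n - 1, by omega⟩
      have hest : ∀ j a, estimate f R (fun k => X k ω) (k + 1) j a
          = estimate f R (fun k => X k ω) k j a := fun j a => by
        rw [estimate, if_neg fun hk => h hk.1]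
      simp only [Nat.add_sub_cancel] at h1 h2 ih ⊢
      simp only [h1, h2, hest]
      exact ih h

/-- If the estimates are off by less than `d / 2`, the optimal policies are played. -/
lemma IsMCLPSM.action_channel_optimal [Finite A] [DecidableEq S]
    (halg : IsMCLPSM 𝓜 f R ℱ X st ac ch β φ) (hergodic : 𝓜.IsErgodic) (hγ : 𝓜.gamma m < 1) {w : ℝ} (hw : 0 < w)
    (hR : IsExplorationSequence M w R) {d : ℝ} (hd : (d : EReal) ≤ min (delta3 m) (𝓜.delta4 m))
    {n : ℕ} (hn : 2 ≤ n) (hnR : n ∉ R) {ω : Ω}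
    (hθ : ∀ a j, |estimate f R (fun k => X k ω) (n - 1) j a - m j a| < d / 2) :
    ac n ω = 𝓜.bestPolicy m (st n ω) ∧ m (ch n ω) (ac n ω) = bestRate m (ac n ω) := by
  have : Nonempty S := ⟨st n ω⟩
  obtain ⟨h1, h2⟩ := halg.policies_in_force hw hR hn hnR ω
  obtain ⟨h3, h4⟩ := halg.exploit n (by omega) hnR ω
  have h5 := eq_bestRate_of_abs_sub_lt (hd.trans (min_le_left _ _)) hθ h1
  have h6 := eq_bestPolicy_of_abs_sub_lt hergodic hγ (hd.trans (min_le_right _ _))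
    (fun a => by simpa only [h5] using hθ a (φ n ω a)) h2
  rw [h4, h5, h3, h6]
  exact ⟨rfl, rfl⟩

end Policies

/-! ### Expectations in a controlled system -/

section Expectation

lemma measurable_comp_of_measurableSet_fiber {Ω α : Type*} [Finite α] {mΩ : MeasurableSpace Ω}
    {Y : Ω → α} (hY : ∀ a, MeasurableSet {ω | Y ω = a}) (g : α → ℝ) :
    Measurable fun ω => g (Y ω) := by
  let _ : MeasurableSpace α := ⊤
  exact (measurable_of_finite g).comp (measurable_to_countable' hY)

lemma integrable_comp_of_measurableSet_fiber {Ω α : Type*} [Finite α] {mΩ : MeasurableSpace Ω}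
    {Pr : Measure Ω} [IsFiniteMeasure Pr] {Y : Ω → α} (hY : ∀ a, MeasurableSet {ω | Y ω = a})
    (g : α → ℝ) : Integrable (fun ω => g (Y ω)) Pr := by
  obtain ⟨C, hC⟩ := (Set.finite_range fun a => ‖g a‖).bddAbove
  exact Integrable.of_bound (measurable_comp_of_measurableSet_fiber hY g).aestronglyMeasurable C
    (ae_of_all _ fun ω => hC ⟨Y ω, rfl⟩)

variable {S A 𝒳 Ω : Type*} [Fintype S] [MeasurableSpace 𝒳] {mΩ : MeasurableSpace Ω}
  {Pr : Measure Ω} {M : ℕ} {𝓜 : MDP S A} {f : A → 𝒳 → ℝ}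
  {ν : Fin M → Measure 𝒳} {ℱ : Filtration ℕ mΩ} {X : ℕ → Ω → Fin M → 𝒳} {st : ℕ → Ω → S}
  {ac : ℕ → Ω → A} {ch : ℕ → Ω → Fin M}

lemma IsControlledSystem.measurableSet_fiber (hsys : IsControlledSystem 𝓜 ν Pr ℱ X st ac ch)
    {n : ℕ} (hn : 1 ≤ n) (p : S × A × Fin M) :
    MeasurableSet[ℱ n] {ω | (st n ω, ac n ω, ch n ω) = p} := by
  obtain ⟨s, a, j⟩ := p
  simp only [Prod.mk.injEq]
  exact (hsys.state_adapted n hn s).inter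
    ((hsys.action_adapted n hn a).inter (hsys.channel_adapted n hn j))

variable [Finite A] [IsProbabilityMeasure Pr]

lemma IsControlledSystem.integrable_decision (hsys : IsControlledSystem 𝓜 ν Pr ℱ X st ac ch)
    {n : ℕ} (hn : 1 ≤ n) (g : S → A → Fin M → ℝ) :
    Integrable (fun ω => g (st n ω) (ac n ω) (ch n ω)) Pr :=
  integrable_comp_of_measurableSet_fiber (fun p => ℱ.le n _ (hsys.measurableSet_fiber hn p))
    fun p : S × A × Fin M => g p.1 p.2.1 p.2.2

/-- The expected rate of a slot is the expected mean rate of the chosen channel and action. -/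
lemma IsControlledSystem.integral_reward (hsys : IsControlledSystem 𝓜 ν Pr ℱ X st ac ch)
    (hf_meas : ∀ a, Measurable (f a)) (hf_nonneg : ∀ a x, 0 ≤ f a x)
    (hf_bdd : ∀ a, BddAbove (Set.range (f a))) {n : ℕ} (hn : 1 ≤ n) :
    Integrable (fun ω => f (ac n ω) (X n ω (ch n ω))) Pr ∧
    ∫ ω, f (ac n ω) (X n ω (ch n ω)) ∂Pr = ∫ ω, meanRate f ν (ch n ω) (ac n ω) ∂Pr := by
  classical
  have := Fintype.ofFinite A
  -- Splitting over the finitely many decisions reduces to fixed `a` and `j`, where the indicator,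
  -- known at slot `n`, is independent of the gain.
  let I : S × A × Fin M → Ω → ℝ := fun p ω => if (st n ω, ac n ω, ch n ω) = p then 1 else 0
  have hI : ∀ p, Measurable[ℱ n] (I p) := fun p =>
    measurable_comp_of_measurableSet_fiber (hsys.measurableSet_fiber hn) fun q =>
      if q = p then (1 : ℝ) else 0
  have hI_int : ∀ p, Integrable (I p) Pr := fun p =>
    integrable_comp_of_measurableSet_fiber
      (fun q => ℱ.le n _ (hsys.measurableSet_fiber hn q)) fun q => if q = p then (1 : ℝ) else 0
  have hfX : ∀ p : S × A × Fin M, Integrable (fun ω => f p.2.1 (X n ω p.2.2)) Pr := fun p => by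
    obtain ⟨C, hC⟩ := hf_bdd p.2.1
    refine Integrable.of_bound
      ((hf_meas _).comp (hsys.measurable_gain hn _)).aestronglyMeasurable C (ae_of_all _ fun ω => ?_)
    rw [Real.norm_of_nonneg (hf_nonneg _ _)]
    exact hC ⟨_, rfl⟩
  have hind : ∀ p : S × A × Fin M, I p ⟂ᵢ[Pr] fun ω => f p.2.1 (X n ω p.2.2) := fun p =>
    hsys.indepFun_rate hf_meas hn p.2.2 p.2.1 (hI p)
  have hint : ∀ p : S × A × Fin M, Integrable (fun ω => I p ω * f p.2.1 (X n ω p.2.2)) Pr :=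
    fun p => (hind p).integrable_mul (hI_int p) (hfX p)
  have hdec : (fun ω => f (ac n ω) (X n ω (ch n ω))) =
      fun ω => ∑ p : S × A × Fin M, I p ω * f p.2.1 (X n ω p.2.2) := by
    ext ω
    simp [I]
  have hdec' : (fun ω => meanRate f ν (ch n ω) (ac n ω)) =
      fun ω => ∑ p : S × A × Fin M, I p ω * meanRate f ν p.2.2 p.2.1 := by
    ext ω
    simp [I]
  rw [hdec, hdec']
  refine ⟨integrable_finsetSum _ fun p _ => hint p, ?_⟩
  rw [integral_finsetSum _ fun p _ => hint p,
    integral_finsetSum _ fun p _ => (hI_int p).mul_const _]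
  refine Finset.sum_congr rfl fun p _ => ?_
  rw [(hind p).integral_fun_mul_eq_mul_integral (hI_int p).1 (hfX p).1, integral_mul_const,
    hsys.integral_rate hf_meas hn]

/-- The expectation of a function of the next state. -/
lemma IsControlledSystem.integral_next_state (hsys : IsControlledSystem 𝓜 ν Pr ℱ X st ac ch)
    {n : ℕ} (hn : 1 ≤ n) (h : S → ℝ) :
    ∫ ω, h (st (n + 1) ω) ∂Pr = ∫ ω, ∑ s', 𝓜.trans (st n ω) (ac n ω) s' * h s' ∂Pr := by
  classical
  have hset : ∀ s', MeasurableSet {ω | st (n + 1) ω = s'} := fun s' =>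
    ℱ.le (n + 1) _ (hsys.state_adapted (n + 1) (by omega) s')
  have hdec : (fun ω => h (st (n + 1) ω)) =
      fun ω => ∑ s', ({ω | st (n + 1) ω = s'}.indicator (fun _ => (1 : ℝ)) ω) * h s' := by
    ext ω
    simp [Set.indicator_apply]
  have hint : ∀ s', Integrable ({ω | st (n + 1) ω = s'}.indicator fun _ => (1 : ℝ)) Pr :=
    fun s' => (integrable_const _).indicator (hset s')
  rw [hdec, integral_finsetSum _ fun s' _ => (hint s').mul_const _, integral_finsetSum _ fun s' _ =>
    (hsys.integrable_decision hn fun s a _ => 𝓜.trans s a s').mul_const _]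
  refine Finset.sum_congr rfl fun s' _ => ?_
  rw [integral_mul_const, integral_mul_const, ← integral_congr_ae (hsys.transition n hn s'),
    integral_condExp]

/-- The regret of a controlled system whose slot losses are bounded through a telescoping
potential. -/
lemma IsControlledSystem.regret_le (hsys : IsControlledSystem 𝓜 ν Pr ℱ X st ac ch)
    (hf_meas : ∀ a, Measurable (f a)) (hf_nonneg : ∀ a x, 0 ≤ f a x)
    (hf_bdd : ∀ a, BddAbove (Set.range (f a))) {ρ : ℝ} {H p : ℕ → ℝ}
    (hloss : ∀ n, 1 ≤ n → ρ - ∫ ω, f (ac n ω) (X n ω (ch n ω)) ∂Pr ≤ H (n + 1) - H n + p n)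
    (T : ℕ) : regret Pr f ρ X ac ch T ≤ H (T + 1) - H 1 + ∑ n ∈ Finset.Icc 1 T, p n := by
  rw [regret, integral_finsetSum _ fun n hn =>
    (hsys.integral_reward hf_meas hf_nonneg hf_bdd (Finset.mem_Icc.1 hn).1).1]
  induction T with
  | zero => simp
  | succ T ih =>
    rw [Finset.sum_Icc_succ_top (by omega), Finset.sum_Icc_succ_top (by omega)]
    have := hloss (T + 1) (by omega)
    push_cast
    linarith

end Expectation

/-! ### The regret bound -/

section Regret

/-- The unused first term of the series is kept as `- 1`: it later pays for slot 1 and the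
telescoping boundary. -/
lemma sum_Icc_two_rpow_le {x : ℝ} (hx : Summable fun t : ℕ => ((t : ℝ) + 1) ^ (-x)) {T : ℕ}
    (hT : 1 ≤ T) : ∑ n ∈ Finset.Icc 2 T, (n : ℝ) ^ (-x) ≤ zetaSum x - 1 := by
  have h1 := hx.sum_le_tsum (Finset.range T) fun t _ => by positivity
  have h2 : ∑ t ∈ Finset.range T, ((t : ℝ) + 1) ^ (-x)
      = 1 + ∑ n ∈ Finset.Icc 2 T, (n : ℝ) ^ (-x) := by
    clear h1
    induction T, hT using Nat.le_induction with
    | base => simp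
    | succ t ht ih =>
      rw [Finset.sum_range_succ, ih, Finset.sum_Icc_succ_top (by omega)]
      push_cast
      ring
  rw [zetaSum]
  linarith

lemma sum_Icc_ite_le {M : ℕ} {w x C : ℝ} {R : Set ℕ} [DecidablePred (· ∈ R)] (hw : 0 < w)
    (hR : IsExplorationSequence M w R) (hx : Summable fun t : ℕ => ((t : ℝ) + 1) ^ (-x))
    (hC : 0 ≤ C) {T : ℕ} (hT : 1 ≤ T) :
    ∑ n ∈ Finset.Icc 1 T, (if n = 1 ∨ n ∈ R then 1 else C * (n : ℝ) ^ (-x)) ≤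
      1 + M * (⌈w * Real.log T⌉ : ℝ) + C * (zetaSum x - 1) := by
  have h1 : ((((Finset.Icc 2 T).filter (· ∈ R)).card : ℤ) : ℝ) ≤ M * (⌈w * Real.log T⌉ : ℝ) := by
    exact_mod_cast hR.card_filter_le hw hT
  have h2 : ∑ n ∈ Finset.Icc 2 T, (if n = 1 ∨ n ∈ R then 1 else C * (n : ℝ) ^ (-x)) ≤
      ∑ n ∈ Finset.Icc 2 T, ((if n ∈ R then 1 else 0) + C * (n : ℝ) ^ (-x)) := by
    refine Finset.sum_le_sum fun n hn => ?_
    have hn1 : n ≠ 1 := by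
      have := (Finset.mem_Icc.1 hn).1
      omega
    have : 0 ≤ C * (n : ℝ) ^ (-x) := by positivity
    simp only [hn1, false_or]
    split_ifs <;> linarith
  rw [Finset.sum_add_distrib, ← Finset.mul_sum, Finset.sum_boole] at h2
  have h3 := mul_le_mul_of_nonneg_left (sum_Icc_two_rpow_le hx hT) hC
  rw [← Finset.insert_Icc_add_one_left_eq_Icc hT, Finset.sum_insert (by simp)]
  simp only [true_or, if_true]
  push_cast at h1
  norm_num at h2 ⊢
  linarith

variable {S A : Type*} [Fintype S] [Finite A] {M : ℕ} [NeZero M] {𝓜 : MDP S A} {m : Fin M → A → ℝ}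

lemma bestRate_le_muMax (m : Fin M → A → ℝ) (a : A) : bestRate m a ≤ muMax m :=
  le_ciSup (f := fun a => bestRate m a) (Set.finite_range _).bddAbove a

lemma optRate_sub_le_deltaMax (𝓜 : MDP S A) (m : Fin M → A → ℝ) (j : Fin M) (a : A) :
    𝓜.optRate m - m j a ≤ 𝓜.deltaMax m :=
  sub_le_sub_left
    (ciInf_le (f := fun p : A × Fin M => m p.2 p.1) (Set.finite_range _).bddBelow (a, j)) _

/-- `ρ*` is a weighted average of mean rates, so it is at least their minimum. -/
lemma deltaMax_nonneg [Nonempty S] (𝓜 : MDP S A) (m : Fin M → A → ℝ) : 0 ≤ 𝓜.deltaMax m := by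
  have hst := MDP.isStationary_stationaryDist (𝓜.bestPolicy m)
  have h : ∑ s, 𝓜.stationaryDist (𝓜.bestPolicy m) s * (𝓜.optRate m - 𝓜.deltaMax m)
      ≤ 𝓜.optRate m := Finset.sum_le_sum fun s _ => by
    refine mul_le_mul_of_nonneg_left ?_ (hst.1 s)
    linarith [optRate_sub_le_deltaMax 𝓜 m (bestChannel m (𝓜.bestPolicy m s)) (𝓜.bestPolicy m s)]
  rw [← Finset.sum_mul, hst.2.1] at h
  linarith

/-- The bias function of the optimal policy, with its oscillation. -/
lemma exists_bias [Nonempty S] (hm : ∀ j a, 0 ≤ m j a) (hγ : 𝓜.gamma m < 1) :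
    ∃ h : S → ℝ, (∀ s, bestRate m (𝓜.bestPolicy m s)
        + ∑ s', 𝓜.trans s (𝓜.bestPolicy m s) s' * h s' = 𝓜.optRate m + h s) ∧
      ∀ s s', h s - h s' ≤ muMax m / (1 - 𝓜.gamma m) := by
  obtain ⟨h, hh⟩ := exists_poisson (MDP.chain_sum _) hγ
    (MDP.isStationary_stationaryDist (𝓜.bestPolicy m)) fun s => bestRate m (𝓜.bestPolicy m s)
  refine ⟨h, hh, sub_le_div_of_poisson (MDP.chain_sum _) hγ hh fun s s' => ?_⟩
  have h1 := bestRate_le_muMax m (𝓜.bestPolicy m s)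
  have h2 : 0 ≤ bestRate m (𝓜.bestPolicy m s') := hm _ _
  linarith

/-- The expected loss of any action against the optimal rate, corrected by the bias function, is at
most the bias oscillation plus `Δ_max`. -/
lemma optRate_sub_le {h : S → ℝ} {D : ℝ} (hD : ∀ s s', h s - h s' ≤ D) {s : S} {a : A}
    (ha : a ∈ 𝓜.act s) (j : Fin M) :
    𝓜.optRate m + h s - ∑ s', 𝓜.trans s a s' * h s' - m j a ≤ 𝓜.deltaMax m + D := by
  have h1 := optRate_sub_le_deltaMax 𝓜 m j a
  have h2 : ∑ s', 𝓜.trans s a s' * (h s - h s') ≤ ∑ s', 𝓜.trans s a s' * D :=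
    Finset.sum_le_sum fun s' _ => mul_le_mul_of_nonneg_left (hD s s') (𝓜.trans_nonneg s a ha s')
  simp only [mul_sub, Finset.sum_sub_distrib, ← Finset.sum_mul, 𝓜.trans_sum s a ha, one_mul] at h2
  linarith

variable {𝒳 Ω : Type*} [MeasurableSpace 𝒳] {mΩ : MeasurableSpace Ω} {Pr : Measure Ω}
  [IsProbabilityMeasure Pr] {f : A → 𝒳 → ℝ} {ν : Fin M → Measure 𝒳} {R : Set ℕ}
  {ℱ : Filtration ℕ mΩ} {X : ℕ → Ω → Fin M → 𝒳} {st : ℕ → Ω → S} {ac : ℕ → Ω → A}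
  {ch : ℕ → Ω → Fin M}

/-- The expected loss in a slot in which optimal decisions are taken outside the event `B`. -/
lemma IsControlledSystem.optRate_sub_integral_le (hsys : IsControlledSystem 𝓜 ν Pr ℱ X st ac ch)
    (hf_meas : ∀ a, Measurable (f a)) (hf_nonneg : ∀ a x, 0 ≤ f a x)
    (hf_bdd : ∀ a, BddAbove (Set.range (f a))) {n : ℕ} (hn : 1 ≤ n) {h : S → ℝ} {D : ℝ}
    (hh : ∀ s, bestRate (meanRate f ν) (𝓜.bestPolicy (meanRate f ν) s)
      + ∑ s', 𝓜.trans s (𝓜.bestPolicy (meanRate f ν) s) s' * h s'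
        = 𝓜.optRate (meanRate f ν) + h s)
    (hD : ∀ s s', h s - h s' ≤ D) {B : Set Ω} (hB : MeasurableSet B)
    (hopt : ∀ ω ∉ B, ac n ω = 𝓜.bestPolicy (meanRate f ν) (st n ω) ∧
      meanRate f ν (ch n ω) (ac n ω) = bestRate (meanRate f ν) (ac n ω)) :
    𝓜.optRate (meanRate f ν) - ∫ ω, f (ac n ω) (X n ω (ch n ω)) ∂Pr ≤
      ∫ ω, h (st (n + 1) ω) ∂Pr - ∫ ω, h (st n ω) ∂Pr
        + (𝓜.deltaMax (meanRate f ν) + D) * Pr.real B := by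
  set m := meanRate f ν
  have hle : ∀ ω, 𝓜.optRate m + h (st n ω) - ∑ s', 𝓜.trans (st n ω) (ac n ω) s' * h s'
      - m (ch n ω) (ac n ω) ≤ B.indicator (fun _ => 𝓜.deltaMax m + D) ω := fun ω => by
    by_cases hω : ω ∈ B
    · rw [Set.indicator_of_mem hω]
      exact optRate_sub_le hD (hsys.action_valid n hn ω) _
    -- Under optimal decisions the Poisson equation makes the corrected loss exactly zero.
    · rw [Set.indicator_of_notMem hω, (hopt ω hω).2, (hopt ω hω).1]
      have := hh (st n ω)
      linarith
  have hi1 : Integrable (fun ω => h (st n ω)) Pr := hsys.integrable_decision hn fun s _ _ => h s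
  have hi2 : Integrable (fun ω => ∑ s', 𝓜.trans (st n ω) (ac n ω) s' * h s') Pr :=
    hsys.integrable_decision hn fun s a _ => ∑ s', 𝓜.trans s a s' * h s'
  have hi3 : Integrable (fun ω => m (ch n ω) (ac n ω)) Pr :=
    hsys.integrable_decision hn fun _ a j => m j a
  have hmono := integral_mono
    ((((integrable_const (𝓜.optRate m)).add hi1).sub hi2).sub hi3)
    ((integrable_const (𝓜.deltaMax m + D)).indicator hB) hle
  rw [integral_indicator_const _ hB, smul_eq_mul, mul_comm,
    integral_sub' (((integrable_const (𝓜.optRate m)).add hi1).sub hi2) hi3,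
    integral_sub' ((integrable_const (𝓜.optRate m)).add hi1) hi2,
    integral_add' (integrable_const (𝓜.optRate m)) hi1, integral_const, probReal_univ, one_smul,
    ← hsys.integral_next_state hn h] at hmono
  rw [(hsys.integral_reward hf_meas hf_nonneg hf_bdd hn).2]
  linarith

end Regret

end MCLPSM

open MCLPSM
theorem mainTheorem4
    {S A 𝒳 Ω : Type*} [Fintype S] [DecidableEq S] [Fintype A] [MeasurableSpace 𝒳]
    {mΩ : MeasurableSpace Ω} (Pr : Measure Ω) [IsProbabilityMeasure Pr]
    (M : ℕ) [NeZero M]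
    -- the MDP, the rate function and the gain laws of the channels
    (𝓜 : MDP S A) (f : A → 𝒳 → ℝ) (ν : Fin M → Measure 𝒳)
    (hergodic : 𝓜.IsErgodic)
    (hf_meas : ∀ a, Measurable (f a)) (hf_nonneg : ∀ a x, 0 ≤ f a x)
    (hf_bdd : ∀ a, BddAbove (Set.range (f a)))
    (hB₀ : 0 < rateRange f) (hγ : 𝓜.gamma (meanRate f ν) < 1)
    -- the parameters of the algorithm
    (d w : ℝ) (hd : 0 < d)
    (hdΔ : (d : EReal) ≤ min (delta3 (meanRate f ν)) (𝓜.delta4 (meanRate f ν)))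
    (hw : 2 * rateRange f ^ 2 / d ^ 2 < w)
    (R : Set ℕ) (hR : IsExplorationSequence M w R)
    -- a run of MC-LPSM
    (ℱ : Filtration ℕ mΩ) (X : ℕ → Ω → Fin M → 𝒳) (st : ℕ → Ω → S) (ac : ℕ → Ω → A)
    (ch : ℕ → Ω → Fin M) (β : ℕ → Ω → 𝓜.Policy) (φ : ℕ → Ω → A → Fin M)
    (hsys : IsControlledSystem 𝓜 ν Pr ℱ X st ac ch)
    (halg : IsMCLPSM 𝓜 f R ℱ X st ac ch β φ) :
    Summable (fun t : ℕ => ((t : ℝ) + 1) ^ (-(w * d ^ 2 / (2 * rateRange f ^ 2)))) ∧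
    ∀ T : ℕ, 1 ≤ T →
      regret Pr f (𝓜.optRate (meanRate f ν)) X ac ch T ≤
        (M * (⌈w * Real.log T⌉ : ℝ)
            + 2 * Fintype.card A * M * zetaSum (w * d ^ 2 / (2 * rateRange f ^ 2)))
          * (𝓜.deltaMax (meanRate f ν)
            + muMax (meanRate f ν) / (1 - 𝓜.gamma (meanRate f ν))) := by
  classical
  set m := meanRate f ν with hm
  set x := w * d ^ 2 / (2 * rateRange f ^ 2) with hx
  have hw0 : 0 < w := lt_of_le_of_lt (by positivity) hw
  have hx1 : 1 < x := by
    rw [div_lt_iff₀ (by positivity)] at hw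
    rw [hx, one_lt_div (by positivity)]
    exact hw
  have hsum : Summable fun t : ℕ => ((t : ℝ) + 1) ^ (-x) := by
    have := (summable_nat_add_iff 1).2 (Real.summable_nat_rpow.2 (neg_lt_neg hx1))
    simpa using this
  refine ⟨hsum, fun T hT => ?_⟩
  obtain ⟨ω₀⟩ := nonempty_of_isProbabilityMeasure Pr
  have : Nonempty S := ⟨st 1 ω₀⟩
  have : Nonempty A := ⟨ac 1 ω₀⟩
  obtain ⟨h, hh, hD⟩ := exists_bias (𝓜 := 𝓜) (m := m)
    (fun j a => integral_nonneg fun x => hf_nonneg a x) hγ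
  set D := muMax m / (1 - 𝓜.gamma m)
  set C : ℝ := 2 * Fintype.card A * M
  have hD0 : 0 ≤ D := by simpa using hD (st 1 ω₀) (st 1 ω₀)
  have hΔ := deltaMax_nonneg 𝓜 m
  set K := 𝓜.deltaMax m + D
  have hK : 0 ≤ K := add_nonneg hΔ hD0
  have hC : 2 ≤ C := by
    have h1 : (1 : ℝ) ≤ Fintype.card A := by exact_mod_cast Fintype.card_pos
    have h2 : (1 : ℝ) ≤ M := by exact_mod_cast Nat.pos_of_neZero M
    have := one_le_mul_of_one_le_of_one_le h1 h2
    simp only [C]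
    linarith
  have hloss : ∀ n, 1 ≤ n → 𝓜.optRate m - ∫ ω, f (ac n ω) (X n ω (ch n ω)) ∂Pr ≤
      ∫ ω, h (st (n + 1) ω) ∂Pr - ∫ ω, h (st n ω) ∂Pr
        + K * (if n = 1 ∨ n ∈ R then 1 else C * (n : ℝ) ^ (-x)) := fun n hn => by
    split_ifs with hcase
    -- Nothing is known about the decision here, so the whole space serves as the bad event.
    · have := hsys.optRate_sub_integral_le hf_meas hf_nonneg hf_bdd hn hh hD MeasurableSet.univ
        fun ω hω => (hω (Set.mem_univ ω)).elim
      rwa [probReal_univ] at this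
    · rw [not_or] at hcase
      have hn2 : 2 ≤ n := by omega
      have hmeas : MeasurableSet {ω | ∃ a j, d / 2 ≤
          |estimate f R (fun k => X k ω) (n - 1) j a - m j a|} := by
        simp only [Set.ofPred_exists]
        refine MeasurableSet.iUnion fun a => MeasurableSet.iUnion fun j =>
          measurableSet_le measurable_const ?_
        exact (((hsys.measurable_estimate hf_meas (n - 1) j a).mono (ℱ.le _) le_rfl).sub_const
          _).norm
      refine (hsys.optRate_sub_integral_le hf_meas hf_nonneg hf_bdd hn hh hD hmeas
        fun ω hω => ?_).trans (add_le_add_right (mul_le_mul_of_nonneg_left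
          (hsys.measureReal_exists_abs_estimate_sub_ge hf_meas hf_nonneg hf_bdd hw0 hd.le hR hn2
            hcase.2) hK) _)
      refine halg.action_channel_optimal hergodic hγ hw0 hR hdΔ hn2 hcase.2 fun a j => ?_
      by_contra! hcon
      exact hω ⟨a, j, hcon⟩
  have hreg := hsys.regret_le hf_meas hf_nonneg hf_bdd
    (H := fun n => ∫ ω, h (st n ω) ∂Pr) hloss T
  have hbdry : ∫ ω, h (st (T + 1) ω) ∂Pr - ∫ ω, h (st 1 ω) ∂Pr ≤ D := by
    have hi1 : Integrable (fun ω => h (st (T + 1) ω)) Pr :=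
      hsys.integrable_decision (by omega) fun s _ _ => h s
    have hi2 : Integrable (fun ω => h (st 1 ω)) Pr :=
      hsys.integrable_decision le_rfl fun s _ _ => h s
    rw [← integral_sub hi1 hi2]
    refine (integral_mono (hi1.sub hi2) (integrable_const D) fun ω => hD _ _).trans_eq ?_
    simp
  have hcount := mul_le_mul_of_nonneg_left
    (sum_Icc_ite_le hw0 hR hsum (zero_le_two.trans hC) hT) hK
  rw [← Finset.mul_sum] at hreg
  have h2 := mul_le_mul_of_nonneg_right hC hK
  -- The boundary `D` and the cost `K` of slot 1 total at most `2 * K`, as `Δ_max ≥ 0`; the saved `C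
  -- * K` absorbs them because `2 ≤ C`.
  calc _ ≤ D + K * (1 + M * (⌈w * Real.log T⌉ : ℝ) + C * (zetaSum x - 1)) := by linarith
    _ = (M * (⌈w * Real.log T⌉ : ℝ) + C * zetaSum x) * K + (D + K - C * K) := by ring
    _ ≤ (M * (⌈w * Real.log T⌉ : ℝ) + C * zetaSum x) * K := by linarith
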